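/- Let $\mathbf G=(G,W)$ be an infinite, countable, undirected weighted graph of bounded degree: $W=(W_{ij})_{i,j\in G}$ is a real symmetric matrix, $\deg(\mathbf G):=\max_i \#\{j: W_{ij}\neq 0\}<\infty$, and $W$ is normalized so that $|W_{ij}|\le 1/\deg(\mathbf G)$. Then $W$ acts on $\ell^2(G)$ as a bounded self-adjoint operator with norm at most $1$; let $\mathrm{Sp}(W)\subset\mathbb R$ be its spectrum, $I$ the convex hull of $\mathrm{Sp}(W)$, $E$ its resolution of the identity, and $\mu_{ij}(\omega)=\langle E(\omega)\delta_i,\delta_j\rangle$ for $i,j\in G$ and Borel sets $\omega$. For a continuous $f$ on $\mathrm{Sp}(W)$ put $\mathcal K(f)=f(W)=\int f\,dE$. Let $G_0\subset G_1\subset\cdots$ be finite subsets of $G$ with $m_n=\#G_n\to\infty$, let $\delta_n=\#\{i\in G_n:\exists j\in G\setminus G_n,\ W_{ij}\ne0\}$, and for a function $f$ let $\mathcal K_n(f)=(\mathcal K(f)_{ij})_{i,j\in G_n}$. Assume 1. $\delta_n=o(m_n)$; 2. there is a finite positive measure $\mu$ on $\mathbb R$ such that $\frac1{m_n}\sum_{i\in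 G_n}\mu_{ii}\to\mu$ weakly. Let $\Theta=[a,b]\subset\mathbb R$ be a compact interval, $\rho>0$, and let $(f_\theta)_{\theta\in\Theta}$ be a family of functions such that 3. (a) $\theta\mapsto f_\theta$ is injective modulo $\mu$-null sets, that is, $f_\theta=f_{\theta'}$ $\mu$-almost everywhere implies $\theta=\theta'$; (b) $\theta\mapsto f_\theta(\lambda)$ is continuous on $\Theta$ for every $\lambda\in\mathrm{Sp}(W)$; (c) each $f_\theta$ is a positive analytic function on $I$ with $\alpha(\log f_\theta)\le\rho$, that is, $\log f_\theta(x)=\sum_{k\ge0}c_kx^k$ on $I$ with $\sum_{k\ge 0}(k+1)|c_k|\le\rho$. Let $\theta_0$ be an interior point of $\Theta$ and let $X=(X_i)_{i\in G}$ be a centered Gaussian process with covariance $\mathrm{Cov}(X_i,X_j)=\mathcal K(f_{\theta_0})_{ij}$, with law denoted $P_{f_{\theta_0}}$; write $X_n=(X_i)_{i\in G_n}$. Define $$L_n(\theta)=-\tfrac12\big(m_n\log(2\pi)+\log\det\mathcal K_n(f_\theta)+X_n^T\mathcal K_n(f_\theta)^{-1}X_n\big),$$ $$\bar L_n(\theta)=-\tfrac12\Big(m_n\log(2\pi)+m_n\int\log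 f_\theta\,d\mu+X_n^T\mathcal K_n(f_\theta)^{-1}X_n\Big),$$ $$\tilde L_n(\theta)=-\tfrac12\Big(m_n\log(2\pi)+m_n\int\log f_\theta\,d\mu+X_n^T\mathcal K_n(1/f_\theta)X_n\Big).$$ Then each of these functions has a maximizer on $\Theta$, and any sequences of maximizers $\hat\theta_n$ of $L_n$, $\bar\theta_n$ of $\bar L_n$ and $\tilde\theta_n$ of $\tilde L_n$ over $\Theta$ converge to $\theta_0$, $P_{f_{\theta_0}}$-almost surely. Let moreover $P\ge1$ be an integer and, for $i,j\in G_n$, let $$B^{(n)}_{ij}=\frac{\#\{(k,l)\in G_n\times G:\mu_{kl}=\mu_{ij}\}}{\#\{(k,l)\in G_n\times G_n:\mu_{kl}=\mu_{ij}\}}$$ if the graph distance of $i$ and $j$ in $\mathbf G$ is at most $P$, and $B^{(n)}_{ij}=1$ otherwise. If there is a positive sequence $u_n\to0$ with $\sup_{i,j\in G_n}|B^{(n)}_{ij}-1|\le u_n$ for all $n$, then the same conclusion holds for the maximizers $\theta^{(u)}_n$ over $\Theta$ of $$L^{(u)}_n(\theta)=-\tfrac12\Big(m_n\log(2\pi)+m_n\int\log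 f_\theta\,d\mu+X_n^T\big(B^{(n)}\odot\mathcal K_n(1/f_\theta)\big)X_n\Big),$$ where $\odot$ is the entrywise product of matrices. -/

import Mathlib

open Filter Topology MeasureTheory ProbabilityTheory
open scoped Matrix ENNReal NNReal CompactlySupported

noncomputable section

/-! ### Scalar spectral measures of a bounded self-adjoint operator -/

section SpectralMeasure

variable {H : Type*} [NormedAddCommGroup H] [InnerProductSpace ℂ H] [CompleteSpace H]

/-- The operator `f(A) = ∫ f(λ) dE(λ)` for a self-adjoint operator `A` with resolution of the
identity `E`, and a function `f` continuous on the spectrum of `A`. -/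
def operatorFunction (A : H →L[ℂ] H) (f : ℝ → ℝ) : H →L[ℂ] H := cfc f A

/-- For a self-adjoint operator `A` and a vector `v`, the positive functional
`g ↦ ⟨g(A) v, v⟩` on the continuous functions on the (compact) spectrum of `A`. -/
def spectralFunctional (A : H →L[ℂ] H) (hA : IsSelfAdjoint A) (v : H) :
    C_c(spectrum ℝ A, ℝ) →ₚ[ℝ] ℝ :=
  PositiveLinearMap.mk₀
    { toFun := fun g => (inner ℂ v (cfcHom (R := ℝ) hA g.toContinuousMap v)).re
      map_add' := fun g h => by
        have : (g + h).toContinuousMap = g.toContinuousMap + h.toContinuousMap := rfl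
        rw [this, map_add]
        simp
      map_smul' := fun c g => by
        have : (c • g).toContinuousMap = c • g.toContinuousMap := rfl
        rw [this, map_smul]
        simp [inner_smul_right_eq_smul] }
    (fun g hg => by
      have h0 : (0 : H →L[ℂ] H) ≤ cfcHom (R := ℝ) hA g.toContinuousMap :=
        cfcHom_nonneg_iff hA |>.2 fun x => hg x
      have := (ContinuousLinearMap.nonneg_iff_isPositive _).1 h0
      simpa using (Complex.le_def.1 (this.inner_nonneg_right v)).1)

/-- The spectral measure `ω ↦ ⟨E(ω) v, v⟩` of `A` at `v`, where `E` is the resolution of the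
identity of `A`: the measure on the spectrum (seen as a measure on `ℝ`) which represents
`g ↦ ⟨g(A) v, v⟩`. -/
def spectralMeasure (A : H →L[ℂ] H) (hA : IsSelfAdjoint A) (v : H) : Measure ℝ :=
  (RealRMK.rieszMeasure (spectralFunctional A hA v)).map Subtype.val

instance (A : H →L[ℂ] H) (hA : IsSelfAdjoint A) (v : H) :
    IsFiniteMeasure (spectralMeasure A hA v) := by
  unfold spectralMeasure
  infer_instance

end SpectralMeasure

/-! ### Weighted graphs and their adjacency operator -/

/-- An undirected weighted graph of bounded degree with vertex set `G`, with renormalized weights: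
the entries of the symmetric adjacency operator `W` lie in `[-1/deg, 1/deg]`, where `deg` is the
maximal number of neighbours of a vertex. -/
structure WeightedGraph (G : Type*) where
  W : G → G → ℝ
  symm : ∀ i j, W i j = W j i
  finite_neighbors : ∀ i, {j | W i j ≠ 0}.Finite
  bddAbove_degree : BddAbove (Set.range fun i => {j | W i j ≠ 0}.ncard)
  abs_le : ∀ i j, |W i j| ≤ 1 / ((⨆ i, {j | W i j ≠ 0}.ncard : ℕ) : ℝ)

namespace WeightedGraph

variable {G : Type*} (Γ : WeightedGraph G)

theorem summable_abs (i : G) : Summable fun j => |Γ.W i j| :=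
  summable_of_hasFiniteSupport <| (Γ.finite_neighbors i).subset fun j hj => by
    simpa using hj

theorem tsum_abs_le_one (i : G) : ∑' j, |Γ.W i j| ≤ 1 := by
  classical
  set D : ℕ := ⨆ i, {j | Γ.W i j ≠ 0}.ncard with hD
  have hi : {j | Γ.W i j ≠ 0}.ncard ≤ D := le_ciSup Γ.bddAbove_degree i
  rw [tsum_eq_sum (s := (Γ.finite_neighbors i).toFinset) (fun j hj => by simpa using hj)]
  calc ∑ j ∈ (Γ.finite_neighbors i).toFinset, |Γ.W i j|
      ≤ ∑ _j ∈ (Γ.finite_neighbors i).toFinset, 1 / (D : ℝ) :=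
        Finset.sum_le_sum fun j _ => Γ.abs_le i j
    _ = ({j | Γ.W i j ≠ 0}.ncard : ℝ) * (1 / (D : ℝ)) := by
        rw [Finset.sum_const, nsmul_eq_mul, Set.ncard_eq_toFinset_card _ (Γ.finite_neighbors i)]
    _ ≤ (D : ℝ) * (1 / (D : ℝ)) := by gcongr
    _ ≤ 1 := by
        rw [mul_one_div]
        exact div_self_le_one _

theorem summable_mul (u : G → ℂ) (i : G) : Summable fun j => (Γ.W i j : ℂ) * u j :=
  summable_of_hasFiniteSupport <| (Γ.finite_neighbors i).subset fun j hj => by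
    simp only [Function.mem_support, ne_eq, mul_eq_zero, not_or] at hj
    simpa using hj.1

theorem norm_sq_tsum_le (u : G → ℂ) (i : G) :
    ‖∑' j, (Γ.W i j : ℂ) * u j‖ ^ 2 ≤ ∑' j, |Γ.W i j| * ‖u j‖ ^ 2 := by
  classical
  set s := (Γ.finite_neighbors i).toFinset with hs
  have hz : ∀ j ∉ s, Γ.W i j = 0 := fun j hj => by simpa [hs] using hj
  have h1 : ∑ j ∈ s, |Γ.W i j| ≤ 1 := by
    exact ((Γ.summable_abs i).sum_le_tsum s fun _ _ => abs_nonneg _).trans (Γ.tsum_abs_le_one i)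
  rw [tsum_eq_sum (s := s) (fun j hj => by simp [hz j hj]),
    tsum_eq_sum (s := s) (fun j hj => by simp [hz j hj])]
  calc ‖∑ j ∈ s, (Γ.W i j : ℂ) * u j‖ ^ 2
      ≤ (∑ j ∈ s, |Γ.W i j| * ‖u j‖) ^ 2 := by
        gcongr
        refine (norm_sum_le _ _).trans (le_of_eq ?_)
        simp
    _ ≤ (∑ j ∈ s, |Γ.W i j|) * ∑ j ∈ s, |Γ.W i j| * ‖u j‖ ^ 2 := by
        refine Finset.sum_sq_le_sum_mul_sum_of_sq_le_mul s (fun j _ => abs_nonneg _)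
          (fun j _ => by positivity) fun j _ => le_of_eq (by ring)
    _ ≤ 1 * ∑ j ∈ s, |Γ.W i j| * ‖u j‖ ^ 2 := by
        gcongr
    _ = _ := one_mul _

theorem sum_norm_sq_le (u : lp (fun _ : G => ℂ) 2) (s : Finset G) :
    ∑ i ∈ s, ‖∑' j, (Γ.W i j : ℂ) * u j‖ ^ 2 ≤ ‖u‖ ^ 2 := by
  classical
  have hu : HasSum (fun j => ‖u j‖ ^ 2) (‖u‖ ^ 2) := by
    simpa using lp.hasSum_norm (p := 2) (by norm_num) u
  have hsum : ∀ i, Summable fun j => |Γ.W i j| * ‖u j‖ ^ 2 := fun i =>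
    summable_of_hasFiniteSupport <| (Γ.finite_neighbors i).subset fun j hj => by
      simp only [Function.mem_support, ne_eq, mul_eq_zero, not_or, abs_eq_zero] at hj
      simpa using hj.1
  calc ∑ i ∈ s, ‖∑' j, (Γ.W i j : ℂ) * u j‖ ^ 2
      ≤ ∑ i ∈ s, ∑' j, |Γ.W i j| * ‖u j‖ ^ 2 :=
        Finset.sum_le_sum fun i _ => Γ.norm_sq_tsum_le u i
    _ = ∑' j, ∑ i ∈ s, |Γ.W i j| * ‖u j‖ ^ 2 := (Summable.tsum_finsetSum fun i _ => hsum i).symm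
    _ ≤ ∑' j, ‖u j‖ ^ 2 := by
        refine Summable.tsum_le_tsum (fun j => ?_) (summable_sum fun i _ => hsum i) hu.summable
        rw [← Finset.sum_mul]
        refine mul_le_of_le_one_left (by positivity) ?_
        calc ∑ i ∈ s, |Γ.W i j| = ∑ i ∈ s, |Γ.W j i| := by simp_rw [Γ.symm _ j]
          _ ≤ ∑' i, |Γ.W j i| := (Γ.summable_abs j).sum_le_tsum s fun _ _ => abs_nonneg _
          _ ≤ 1 := Γ.tsum_abs_le_one j
    _ = ‖u‖ ^ 2 := hu.tsum_eq

theorem memℓp_mul (u : lp (fun _ : G => ℂ) 2) :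
    Memℓp (fun i => ∑' j, (Γ.W i j : ℂ) * u j) 2 :=
  memℓp_gen' (C := ‖u‖ ^ 2) fun s => by simpa using Γ.sum_norm_sq_le u s

/-- The adjacency operator `(W u)_i = ∑_j W_ij u_j` on `ℓ²(G)`. (Complex scalars are used so that
the functional calculus is available; all matrix entries below are real.) -/
def op : lp (fun _ : G => ℂ) 2 →L[ℂ] lp (fun _ : G => ℂ) 2 :=
  LinearMap.mkContinuous
    { toFun := fun u => ⟨fun i => ∑' j, (Γ.W i j : ℂ) * u j, Γ.memℓp_mul u⟩
      map_add' := fun u v => by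
        ext i
        simp only [lp.coeFn_add, Pi.add_apply, mul_add]
        exact (Γ.summable_mul u i).tsum_add (Γ.summable_mul v i)
      map_smul' := fun c u => by
        ext i
        simp only [lp.coeFn_smul, Pi.smul_apply, smul_eq_mul, RingHom.id_apply, mul_left_comm _ c]
        exact tsum_mul_left }
    1 fun u => by
      rw [one_mul]
      refine lp.norm_le_of_forall_sum_le (p := 2) (by norm_num) (norm_nonneg u) fun s => ?_
      simpa using Γ.sum_norm_sq_le u s

theorem op_apply (u : lp (fun _ : G => ℂ) 2) (i : G) :
    Γ.op u i = ∑' j, (Γ.W i j : ℂ) * u j := rfl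

/-- The sequence `δ_i = (1_{k = i})_k` of `ℓ²(G)`. -/
def delta (i : G) : lp (fun _ : G => ℂ) 2 :=
  letI := Classical.decEq G
  lp.single 2 i (1 : ℂ)

theorem inner_delta (i : G) (u : lp (fun _ : G => ℂ) 2) : inner ℂ (delta i) u = u i := by
  classical
  rw [delta, Subsingleton.elim (Classical.decEq G) (fun a b => Classical.propDecidable (a = b))]
  rw [lp.inner_single_left]
  simp

theorem op_delta_apply (i j : G) : Γ.op (delta i) j = Γ.W j i := by
  classical
  rw [op_apply, tsum_eq_single i]
  · simp [delta]
  · intro k hk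
    simp [delta, hk]

theorem isSelfAdjoint_op : IsSelfAdjoint Γ.op := by
  rw [ContinuousLinearMap.isSelfAdjoint_iff']
  ext u i
  rw [← inner_delta, ContinuousLinearMap.adjoint_inner_right, lp.inner_eq_tsum, op_apply]
  refine tsum_congr fun j => ?_
  rw [op_delta_apply, Γ.symm j i]
  simp [mul_comm]

/-- The spectrum of the adjacency operator. -/
def Sp : Set ℝ := spectrum ℝ Γ.op

/-- The convex hull of the spectrum of the adjacency operator. -/
def hull : Set ℝ := convexHull ℝ Γ.Sp

/-- The entry `(i, j)` of the operator `𝒦(f) = f(W) = ∫ f(λ) dE(λ)`. -/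
def K (f : ℝ → ℝ) (i j : G) : ℝ := (inner ℂ (delta i) (operatorFunction Γ.op f (delta j))).re

/-- The matrix `𝒦_n(f)`: the restriction of `𝒦(f)` to a finite set of vertices. -/
def Kmat (S : Finset G) (f : ℝ → ℝ) : Matrix S S ℝ := Matrix.of fun i j => Γ.K f i j

/-- The diagonal spectral measure `μ_ii`. -/
def diagMeasure (i : G) : FiniteMeasure ℝ :=
  ⟨spectralMeasure Γ.op Γ.isSelfAdjoint_op (delta i), inferInstance⟩

/-- The averaged diagonal spectral measure `(1/m) ∑_{i ∈ S} μ_ii`, with `m` the cardinality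
of `S`. -/
def avgMeasure (S : Finset G) : FiniteMeasure ℝ :=
  (S.card : ℝ≥0)⁻¹ • ∑ i ∈ S, Γ.diagMeasure i

/-- The real measure `μ_ij(ω) = ⟨E(ω) δ_i, δ_j⟩`, obtained from spectral measures of vectors by
polarization. -/
def pairMeasure (i j : G) : SignedMeasure ℝ :=
  (1 / 4 : ℝ) •
    ((spectralMeasure Γ.op Γ.isSelfAdjoint_op (delta i + delta j)).toSignedMeasure -
      (spectralMeasure Γ.op Γ.isSelfAdjoint_op (delta i - delta j)).toSignedMeasure)

/-- The boundary size `δ_n`: the number of vertices of `S` with a neighbour outside `S`. -/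
def boundaryCard (S : Finset G) : ℕ := {i | i ∈ S ∧ ∃ j, j ∉ S ∧ Γ.W i j ≠ 0}.ncard

/-- The underlying simple graph, used for the graph distance. -/
def graph : SimpleGraph G where
  Adj i j := i ≠ j ∧ Γ.W i j ≠ 0
  symm := ⟨fun i j h => ⟨h.1.symm, by rw [Γ.symm]; exact h.2⟩⟩
  loopless := ⟨fun _ h => h.1 rfl⟩

open Classical in
/-- The boundary correction matrix `B^{(n)}`, with parameter `P`, of the finite set of vertices `S`.
Vertices in different components are at infinite distance. -/
def B (P : ℕ) (S : Finset G) : Matrix S S ℝ := Matrix.of fun i j =>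
  if Γ.graph.edist i j ≤ P then
    ({kl : G × G | kl.1 ∈ S ∧ Γ.pairMeasure kl.1 kl.2 = Γ.pairMeasure i j}.ncard : ℝ) /
      ({kl : G × G | kl.1 ∈ S ∧ kl.2 ∈ S ∧
        Γ.pairMeasure kl.1 kl.2 = Γ.pairMeasure i j}.ncard : ℝ)
  else 1

/-- The matrix `𝒬_n(f) = B^{(n)} ⊙ 𝒦_n(f)`. -/
def Qmat (P : ℕ) (S : Finset G) (f : ℝ → ℝ) : Matrix S S ℝ := Γ.B P S ⊙ Γ.Kmat S f

/-! ### Spectral densities -/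

/-- The class `𝓕_ρ`: positive analytic functions `f` on the convex hull of the spectrum of `W` such
that `log f(x) = ∑ c_k x^k` there, with `α(log f) = ∑ |c_k| (k + 1) ≤ ρ`. -/
structure MemFρ (ρ : ℝ) (f : ℝ → ℝ) : Prop where
  analytic : AnalyticOn ℝ f Γ.hull
  pos : ∀ x ∈ Γ.hull, 0 < f x
  regular : ∃ c : ℕ → ℝ, (∀ x ∈ Γ.hull, HasSum (fun k => c k * x ^ k) (Real.log (f x))) ∧
    Summable (fun k => |c k| * ((k : ℝ) + 1)) ∧ ∑' k, |c k| * ((k : ℝ) + 1) ≤ ρ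

/-! ### Likelihoods, for observations `x` on the finite set of vertices `S` -/

open Classical in
/-- The log-likelihood `L_n`. -/
def logLik (S : Finset G) (f : ℝ → ℝ) (x : S → ℝ) : ℝ :=
  -(1 / 2) * (S.card * Real.log (2 * Real.pi) + Real.log (Γ.Kmat S f).det
    + x ⬝ᵥ ((Γ.Kmat S f)⁻¹ *ᵥ x))

open Classical in
/-- The approximated log-likelihood `L̄_n`. -/
def logLikBar (μ : Measure ℝ) (S : Finset G) (f : ℝ → ℝ) (x : S → ℝ) : ℝ :=
  -(1 / 2) * (S.card * Real.log (2 * Real.pi) + S.card * ∫ t, Real.log (f t) ∂μ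
    + x ⬝ᵥ ((Γ.Kmat S f)⁻¹ *ᵥ x))

/-- The Whittle log-likelihood `L̃_n`. -/
def logLikTilde (μ : Measure ℝ) (S : Finset G) (f : ℝ → ℝ) (x : S → ℝ) : ℝ :=
  -(1 / 2) * (S.card * Real.log (2 * Real.pi) + S.card * ∫ t, Real.log (f t) ∂μ
    + x ⬝ᵥ (Γ.Kmat S (fun t => 1 / f t) *ᵥ x))

/-- The unbiased (tapered) log-likelihood `L^{(u)}_n`. -/
def logLikUnb (μ : Measure ℝ) (P : ℕ) (S : Finset G) (f : ℝ → ℝ) (x : S → ℝ) : ℝ :=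
  -(1 / 2) * (S.card * Real.log (2 * Real.pi) + S.card * ∫ t, Real.log (f t) ∂μ
    + x ⬝ᵥ (Γ.Qmat P S (fun t => 1 / f t) *ᵥ x))

end WeightedGraph

/-- The maximizers over `Θ` of the random criteria `L n · ω` exist, and every sequence of
estimators that maximize them converges almost surely to `θ₀`. -/
def MaximizersConverge {Ω : Type*} [MeasurableSpace Ω] (Pr : Measure Ω) (Θ : Set ℝ) (θ₀ : ℝ)
    (L : ℕ → ℝ → Ω → ℝ) : Prop :=
  (∀ n ω, ∃ θ ∈ Θ, IsMaxOn (fun θ => L n θ ω) Θ θ) ∧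
  ∀ θhat : ℕ → Ω → ℝ,
    (∀ n, ∀ᵐ ω ∂Pr, θhat n ω ∈ Θ ∧ IsMaxOn (fun θ => L n θ ω) Θ (θhat n ω)) →
    ∀ᵐ ω ∂Pr, Tendsto (fun n => θhat n ω) atTop (𝓝 θ₀)

end

/-! For a spectral density `f` and the true density `f₀`, the limit per vertex of `-2` times each
quasi-log-likelihood is, up to a constant, `∫ log f + f₀ / f ∂μ`. Since `log t < t - 1` for
`t ≠ 1`, it has its unique minimum at `f = f₀`.

The limit of the deterministic terms is a Szegő-type theorem: with `x` the identity function,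
`𝒦_n(g) 𝒦_n(x) - 𝒦_n(g x)` is supported on the columns of the boundary vertices of `G_n`, so that
its squared Hilbert–Schmidt norm is `O(δ_n) = o(m_n)`. By uniform polynomial approximation the
defect `𝒦_n(g) 𝒦_n(h) - 𝒦_n(g h)` is therefore invisible in normalized traces for all continuous
`g` and `h`, whence the limits of the traces of polynomials and inverses of `𝒦_n(f)`, and of
`log det 𝒦_n(f)`. The random terms are Gaussian quadratic forms: their exponential moments give
deviation bounds that decay exponentially in `m_n`, and these are summable because the sets `G_n`
are nested, so that `G_n` is determined by its cardinality. All criteria are equicontinuous in the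
parameter, which turns almost sure convergence on a countable dense set of parameters into uniform
convergence, and so into convergence of the minimizers. -/

/-! ### Real matrices -/

section RealMatrix

open Matrix
open scoped MatrixOrder Matrix.Norms.L2Operator

variable {l m n : Type*} [Fintype l] [Fintype m] [Fintype n]

theorem dotProduct_self_eq_norm_sq (x : n → ℝ) : x ⬝ᵥ x = ‖WithLp.toLp 2 x‖ ^ 2 := by
  rw [EuclideanSpace.norm_sq_eq]
  simp [dotProduct, sq]

/-- The squared Hilbert–Schmidt norm `tr(AᵀA)` of a matrix. It is not taken from Mathlib's Frobenius
norm, which would compete as an instance with the operator norm used alongside it. -/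
def frobeniusSq (A : Matrix m n ℝ) : ℝ := ∑ i, ∑ j, A i j ^ 2

theorem frobeniusSq_nonneg (A : Matrix m n ℝ) : 0 ≤ frobeniusSq A :=
  Finset.sum_nonneg fun _ _ => Finset.sum_nonneg fun _ _ => sq_nonneg _

theorem frobeniusSq_transpose (A : Matrix m n ℝ) : frobeniusSq Aᵀ = frobeniusSq A :=
  Finset.sum_comm

theorem frobeniusSq_add_le (A B : Matrix m n ℝ) :
    frobeniusSq (A + B) ≤ 2 * frobeniusSq A + 2 * frobeniusSq B := by
  simp only [frobeniusSq, Finset.mul_sum, ← Finset.sum_add_distrib, ← mul_add]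
  gcongr
  exact add_sq_le

theorem trace_sq_le (A : Matrix n n ℝ) : A.trace ^ 2 ≤ Fintype.card n * frobeniusSq A := by
  calc A.trace ^ 2 ≤ Fintype.card n * ∑ i, A i i ^ 2 :=
        sq_sum_le_card_mul_sum_sq (s := Finset.univ) (f := fun i => A i i)
    _ ≤ Fintype.card n * frobeniusSq A := by
        refine mul_le_mul_of_nonneg_left (Finset.sum_le_sum fun i _ => ?_) (by positivity)
        exact Finset.single_le_sum (f := fun j => A i j ^ 2) (fun _ _ => sq_nonneg _)
          (Finset.mem_univ i)

theorem frobeniusSq_mul_le_left [DecidableEq m] (A : Matrix l m ℝ) (B : Matrix m n ℝ) :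
    frobeniusSq (A * B) ≤ ‖A‖ ^ 2 * frobeniusSq B := by
  rw [← frobeniusSq_transpose, ← frobeniusSq_transpose B]
  simp only [frobeniusSq]
  rw [Finset.mul_sum]
  refine Finset.sum_le_sum fun j _ => ?_
  have hcol := pow_le_pow_left₀ (norm_nonneg _)
    (l2_opNorm_mulVec A (WithLp.toLp 2 fun i => B i j)) 2
  rw [mul_pow] at hcol
  simpa [EuclideanSpace.norm_sq_eq, mul_apply, mulVec, dotProduct] using hcol

theorem frobeniusSq_mul_le_right [DecidableEq n] (A : Matrix l m ℝ) (B : Matrix m n ℝ) :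
    frobeniusSq (A * B) ≤ ‖B‖ ^ 2 * frobeniusSq A := by
  classical
  rw [← frobeniusSq_transpose, transpose_mul, ← l2_opNorm_conjTranspose B,
    ← frobeniusSq_transpose A]
  exact frobeniusSq_mul_le_left Bᵀ Aᵀ

variable [DecidableEq n]

theorem l2_opNorm_le_of_forall_norm_mulVec_le {A : Matrix m n ℝ} {C : ℝ} (hC : 0 ≤ C)
    (h : ∀ x, ‖WithLp.toLp 2 (A *ᵥ x)‖ ≤ C * ‖WithLp.toLp 2 x‖) : ‖A‖ ≤ C :=
  ContinuousLinearMap.opNorm_le_bound _ hC fun x => h x.ofLp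

theorem abs_dotProduct_mulVec_le (A : Matrix m n ℝ) (x : m → ℝ) (y : n → ℝ) :
    |x ⬝ᵥ A *ᵥ y| ≤ ‖A‖ * ‖WithLp.toLp 2 x‖ * ‖WithLp.toLp 2 y‖ := by
  calc |x ⬝ᵥ A *ᵥ y| = |inner ℝ (WithLp.toLp 2 (A *ᵥ y)) (WithLp.toLp 2 x)| := by
        simp [PiLp.inner_apply, dotProduct]
    _ ≤ ‖WithLp.toLp 2 (A *ᵥ y)‖ * ‖WithLp.toLp 2 x‖ := abs_real_inner_le_norm _ _
    _ ≤ (‖A‖ * ‖WithLp.toLp 2 y‖) * ‖WithLp.toLp 2 x‖ := by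
        gcongr
        exact l2_opNorm_mulVec A (WithLp.toLp 2 y)
    _ = ‖A‖ * ‖WithLp.toLp 2 x‖ * ‖WithLp.toLp 2 y‖ := by ring

theorem abs_dotProduct_mulVec_self_le (A : Matrix n n ℝ) (x : n → ℝ) :
    |x ⬝ᵥ A *ᵥ x| ≤ ‖A‖ * (x ⬝ᵥ x) := by
  rw [dotProduct_self_eq_norm_sq, sq, ← mul_assoc]
  exact abs_dotProduct_mulVec_le A x x

theorem abs_trace_le_card_mul_norm (A : Matrix n n ℝ) : |A.trace| ≤ Fintype.card n * ‖A‖ := by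
  have hdiag (i : n) : |A i i| ≤ ‖A‖ := by
    simpa using abs_dotProduct_mulVec_self_le A (Pi.single i 1)
  calc |A.trace| ≤ ∑ i, |A i i| := Finset.abs_sum_le_sum_abs _ _
    _ ≤ ∑ _i : n, ‖A‖ := Finset.sum_le_sum fun i _ => hdiag i
    _ = Fintype.card n * ‖A‖ := by simp

theorem l2_opNorm_le_of_sum_abs_le {A : Matrix m n ℝ} {C : ℝ} (hC : 0 ≤ C)
    (hrow : ∀ i, ∑ j, |A i j| ≤ C) (hcol : ∀ j, ∑ i, |A i j| ≤ C) : ‖A‖ ≤ C := by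
  refine l2_opNorm_le_of_forall_norm_mulVec_le hC fun x => ?_
  refine (sq_le_sq₀ (by positivity) (by positivity)).1 ?_
  have hsq (i : m) : (A *ᵥ x) i ^ 2 ≤ C * ∑ j, |A i j| * x j ^ 2 := by
    calc (A *ᵥ x) i ^ 2 ≤ (∑ j, |A i j|) * ∑ j, |A i j| * x j ^ 2 :=
          Finset.sum_sq_le_sum_mul_sum_of_sq_le_mul _ (fun _ _ => abs_nonneg _)
            (fun _ _ => by positivity) fun j _ => by
              rw [mul_pow, ← sq_abs (A i j)]
              exact le_of_eq (by ring)
      _ ≤ C * ∑ j, |A i j| * x j ^ 2 := by gcongr; exact hrow i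
  calc ‖WithLp.toLp 2 (A *ᵥ x)‖ ^ 2 = ∑ i, (A *ᵥ x) i ^ 2 := by simp [EuclideanSpace.norm_sq_eq]
    _ ≤ ∑ i, C * ∑ j, |A i j| * x j ^ 2 := Finset.sum_le_sum fun i _ => hsq i
    _ = C * ∑ j, (∑ i, |A i j|) * x j ^ 2 := by
        rw [← Finset.mul_sum, Finset.sum_comm]
        simp only [Finset.sum_mul]
    _ ≤ C * ∑ j, C * x j ^ 2 := by gcongr with j; exact hcol j
    _ = (C * ‖WithLp.toLp 2 x‖) ^ 2 := by
        rw [← Finset.mul_sum, mul_pow, EuclideanSpace.norm_sq_eq]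
        simp only [Real.norm_eq_abs, sq_abs]
        ring

theorem smul_one_le_iff {A : Matrix n n ℝ} {c : ℝ} :
    c • 1 ≤ A ↔ A.IsHermitian ∧ ∀ x, c * (x ⬝ᵥ x) ≤ x ⬝ᵥ A *ᵥ x := by
  have hone : (c • (1 : Matrix n n ℝ)).IsHermitian := by simp [IsHermitian]
  rw [le_iff, posSemidef_iff_dotProduct_mulVec]
  refine and_congr ⟨fun h => by simpa using h.add hone, fun h => h.sub hone⟩
    (forall_congr' fun x => ?_)
  simp [sub_mulVec, smul_mulVec]

section BoundedBelow

variable {A A' : Matrix n n ℝ} {c : ℝ}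

theorem posDef_of_smul_one_le {ι : Type*} [Finite ι] [DecidableEq ι] {A : Matrix ι ι ℝ}
    (hc : 0 < c) (hA : c • 1 ≤ A) : A.PosDef := by
  simpa using (PosDef.one.smul hc).add_posSemidef hA

theorem norm_inv_le_of_smul_one_le (hc : 0 < c) (hA : c • 1 ≤ A) : ‖A⁻¹‖ ≤ c⁻¹ := by
  have hu := (posDef_of_smul_one_le hc hA).isUnit.map detMonoidHom
  refine l2_opNorm_le_of_forall_norm_mulVec_le (by positivity) fun x => ?_
  set y := A⁻¹ *ᵥ x with hy
  have hAy : A *ᵥ y = x := by rw [hy, mulVec_mulVec, mul_nonsing_inv _ hu, one_mulVec]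
  have hform : c * ‖WithLp.toLp 2 y‖ ^ 2 ≤ ‖WithLp.toLp 2 y‖ * ‖WithLp.toLp 2 x‖ :=
    calc c * ‖WithLp.toLp 2 y‖ ^ 2 ≤ y ⬝ᵥ x := by
          rw [← dotProduct_self_eq_norm_sq, ← hAy]; exact (smul_one_le_iff.1 hA).2 y
      _ = inner ℝ (WithLp.toLp 2 x) (WithLp.toLp 2 y) := by simp [PiLp.inner_apply, dotProduct]
      _ ≤ ‖WithLp.toLp 2 y‖ * ‖WithLp.toLp 2 x‖ := by
          rw [mul_comm]; exact real_inner_le_norm _ _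
  rw [inv_mul_eq_div, le_div_iff₀ hc]
  rcases (norm_nonneg (WithLp.toLp 2 y)).eq_or_lt with h0 | hpos
  · rw [← h0, zero_mul]; positivity
  · exact le_of_mul_le_mul_left (by linarith) hpos

theorem norm_inv_sub_inv_le (hc : 0 < c) (hA : c • 1 ≤ A) (hA' : c • 1 ≤ A') :
    ‖A⁻¹ - A'⁻¹‖ ≤ c⁻¹ * ‖A - A'‖ * c⁻¹ := by
  have hu := (posDef_of_smul_one_le hc hA).isUnit
  have hu' := (posDef_of_smul_one_le hc hA').isUnit
  calc ‖A⁻¹ - A'⁻¹‖ = ‖A⁻¹ * (A' - A) * A'⁻¹‖ := by rw [Matrix.inv_sub_inv (iff_of_true hu hu')]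
    _ ≤ ‖A⁻¹‖ * ‖A' - A‖ * ‖A'⁻¹‖ := norm_mul₃_le
    _ ≤ c⁻¹ * ‖A - A'‖ * c⁻¹ := by
        rw [norm_sub_rev A']
        gcongr
        exacts [norm_inv_le_of_smul_one_le hc hA, norm_inv_le_of_smul_one_le hc hA']

end BoundedBelow

/-! ### Logarithms of determinants -/

theorem log_det_eq_sum_log_eigenvalues {A : Matrix n n ℝ} (hA : A.PosDef) :
    Real.log A.det = ∑ i, Real.log (hA.isHermitian.eigenvalues i) := by
  rw [hA.isHermitian.det_eq_prod_eigenvalues]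
  exact Real.log_prod fun i _ => (hA.eigenvalues_pos i).ne'

theorem log_det_le_trace_sub_card {A : Matrix n n ℝ} (hA : A.PosDef) :
    Real.log A.det ≤ A.trace - Fintype.card n := by
  rw [log_det_eq_sum_log_eigenvalues hA, hA.isHermitian.trace_eq_sum_eigenvalues]
  calc ∑ i, Real.log (hA.isHermitian.eigenvalues i)
      ≤ ∑ i, (hA.isHermitian.eigenvalues i - 1) :=
        Finset.sum_le_sum fun i _ => Real.log_le_sub_one_of_pos (hA.eigenvalues_pos i)
    _ = _ := by simp

/-- The tangent inequality of the concave function `log det`. Writing `A' = BᵀB` reduces it to the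
case `A' = 1`, since `B⁻ᵀ A B⁻¹` has the determinant and the trace of `A'⁻¹ A`. -/
theorem log_det_sub_log_det_le_trace {A A' : Matrix n n ℝ} (hA : A.PosDef) (hA' : A'.PosDef) :
    Real.log A.det - Real.log A'.det ≤ (A'⁻¹ * (A - A')).trace := by
  have hA'u : IsUnit A'.det := hA'.isUnit.map detMonoidHom
  obtain ⟨B, hB⟩ := CStarAlgebra.nonneg_iff_eq_star_mul_self.1 hA'.posSemidef.nonneg
  rw [star_eq_conjTranspose] at hB
  have hdetB : Bᴴ.det * B.det = A'.det := by rw [hB, det_mul]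
  have hBu : IsUnit B.det := isUnit_of_mul_isUnit_right (hdetB ▸ hA'u)
  have hM : (B⁻¹ᴴ * A * B⁻¹).PosDef :=
    hA.conjTranspose_mul_mul_same (mulVec_injective_of_isUnit ((isUnit_nonsing_inv_iff).2
      ((isUnit_iff_isUnit_det B).2 hBu)))
  have htrace : (B⁻¹ᴴ * A * B⁻¹).trace = (A'⁻¹ * A).trace := by
    rw [trace_mul_comm, hB, Matrix.mul_inv_rev, conjTranspose_nonsing_inv, mul_assoc]
  have hdet : (B⁻¹ᴴ * A * B⁻¹).det = A.det / A'.det := by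
    rw [det_mul, det_mul, conjTranspose_nonsing_inv, det_nonsing_inv, det_nonsing_inv,
      Ring.inverse_eq_inv', ← hdetB, div_eq_mul_inv, mul_inv]
    ring
  have hlog := log_det_le_trace_sub_card hM
  rw [hdet, Real.log_div hA.det_pos.ne' hA'.det_pos.ne', htrace] at hlog
  rwa [mul_sub, trace_sub, nonsing_inv_mul _ hA'u, trace_one]

theorem abs_log_det_sub_log_det_le {A A' : Matrix n n ℝ} {c : ℝ} (hc : 0 < c) (hA : c • 1 ≤ A)
    (hA' : c • 1 ≤ A') :
    |Real.log A.det - Real.log A'.det| ≤ Fintype.card n * (c⁻¹ * ‖A - A'‖) := by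
  have key {A A' : Matrix n n ℝ} (hA : c • 1 ≤ A) (hA' : c • 1 ≤ A') :
      Real.log A.det - Real.log A'.det ≤ Fintype.card n * (c⁻¹ * ‖A - A'‖) :=
    calc Real.log A.det - Real.log A'.det ≤ (A'⁻¹ * (A - A')).trace :=
          log_det_sub_log_det_le_trace (posDef_of_smul_one_le hc hA) (posDef_of_smul_one_le hc hA')
      _ ≤ Fintype.card n * ‖A'⁻¹ * (A - A')‖ :=
          (le_abs_self _).trans (abs_trace_le_card_mul_norm _)
      _ ≤ Fintype.card n * (c⁻¹ * ‖A - A'‖) := by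
          gcongr
          exact (norm_mul_le _ _).trans (by gcongr; exact norm_inv_le_of_smul_one_le hc hA')
  exact abs_sub_le_iff.2 ⟨key hA hA', norm_sub_rev A A' ▸ key hA' hA⟩

theorem trace_aeval_eq_sum_eval_eigenvalues {A : Matrix n n ℝ} (hA : A.IsHermitian)
    (p : Polynomial ℝ) : (Polynomial.aeval A p).trace = ∑ i, p.eval (hA.eigenvalues i) := by
  have hdiag : Polynomial.aeval (diagonal hA.eigenvalues) p =
      diagonal fun i => p.eval (hA.eigenvalues i) := by
    have h := Polynomial.aeval_algHom_apply (diagonalAlgHom ℝ (n := n) (α := ℝ)) hA.eigenvalues p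
    simp only [diagonalAlgHom_apply] at h
    rw [h]
    congr 1
    ext i
    simp
  have hconj := Polynomial.aeval_algHom_apply
    (Unitary.conjStarAlgAut ℝ (Matrix n n ℝ) hA.eigenvectorUnitary) (diagonal hA.eigenvalues) p
  conv_lhs => rw [hA.spectral_theorem]
  rw [RCLike.ofReal_real_eq_id, Function.id_comp, hconj, hdiag, Unitary.conjStarAlgAut_apply,
    trace_mul_cycle, Unitary.coe_star_mul_self, one_mul, trace_diagonal]

theorem abs_eigenvalues_le_norm {A : Matrix n n ℝ} (hA : A.IsHermitian) (i : n) :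
    |hA.eigenvalues i| ≤ ‖A‖ := by
  simpa [hA.mulVec_eigenvectorBasis, norm_smul] using A.l2_opNorm_mulVec (hA.eigenvectorBasis i)

theorem eigenvalues_mem_Icc {A : Matrix n n ℝ} (hA : A.IsHermitian) {c : ℝ} (hcA : c • 1 ≤ A)
    (i : n) : hA.eigenvalues i ∈ Set.Icc c ‖A‖ := by
  have hunit : (hA.eigenvectorBasis i).ofLp ⬝ᵥ (hA.eigenvectorBasis i).ofLp = 1 := by
    simp [dotProduct_self_eq_norm_sq]
  have hform : (hA.eigenvectorBasis i).ofLp ⬝ᵥ A *ᵥ (hA.eigenvectorBasis i).ofLp =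
      hA.eigenvalues i := by
    rw [hA.mulVec_eigenvectorBasis, dotProduct_smul, hunit, smul_eq_mul, mul_one]
  refine ⟨?_, (le_abs_self _).trans (abs_eigenvalues_le_norm hA i)⟩
  simpa [hunit, hform] using (smul_one_le_iff.1 hcA).2 (hA.eigenvectorBasis i).ofLp

theorem abs_log_det_sub_trace_aeval_le {A : Matrix n n ℝ} {c C : ℝ} (hc : 0 < c) (hA : c • 1 ≤ A)
    (hC : ‖A‖ ≤ C) {p : Polynomial ℝ} {ε : ℝ}
    (hp : ∀ t ∈ Set.Icc c C, |Real.log t - p.eval t| ≤ ε) :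
    |Real.log A.det - (Polynomial.aeval A p).trace| ≤ Fintype.card n * ε := by
  have hpos := posDef_of_smul_one_le hc hA
  rw [trace_aeval_eq_sum_eval_eigenvalues hpos.isHermitian, log_det_eq_sum_log_eigenvalues hpos,
    ← Finset.sum_sub_distrib]
  calc _ ≤ ∑ i, |Real.log (hpos.isHermitian.eigenvalues i) -
          p.eval (hpos.isHermitian.eigenvalues i)| := Finset.abs_sum_le_sum_abs _ _
    _ ≤ ∑ _i : n, ε := Finset.sum_le_sum fun i _ =>
        hp _ (Set.Icc_subset_Icc_right hC (eigenvalues_mem_Icc _ hA i))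
    _ = Fintype.card n * ε := by simp

end RealMatrix

/-! ### Functions of the adjacency operator -/

section OperatorFunction

variable {H : Type*} [NormedAddCommGroup H] [InnerProductSpace ℂ H] [CompleteSpace H]
  {A : H →L[ℂ] H}

theorem norm_operatorFunction_le {g : ℝ → ℝ} {C : ℝ} (hC : 0 ≤ C)
    (h : ∀ x ∈ spectrum ℝ A, |g x| ≤ C) : ‖operatorFunction A g‖ ≤ C :=
  norm_cfc_le hC h

theorem operatorFunction_add {g h : ℝ → ℝ} (hg : ContinuousOn g (spectrum ℝ A))
    (hh : ContinuousOn h (spectrum ℝ A)) :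
    operatorFunction A (fun x => g x + h x) = operatorFunction A g + operatorFunction A h :=
  cfc_add A g h hg hh

theorem operatorFunction_sub {g h : ℝ → ℝ} (hg : ContinuousOn g (spectrum ℝ A))
    (hh : ContinuousOn h (spectrum ℝ A)) :
    operatorFunction A (fun x => g x - h x) = operatorFunction A g - operatorFunction A h :=
  cfc_sub g h A hg hh

theorem operatorFunction_mul {g h : ℝ → ℝ} (hg : ContinuousOn g (spectrum ℝ A))
    (hh : ContinuousOn h (spectrum ℝ A)) :
    operatorFunction A (fun x => g x * h x) = operatorFunction A g * operatorFunction A h :=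
  cfc_mul g h A hg hh

theorem operatorFunction_const (hA : IsSelfAdjoint A) (c : ℝ) :
    operatorFunction A (fun _ => c) = (c : ℂ) • 1 := by
  rw [operatorFunction, cfc_const c A hA, Algebra.algebraMap_eq_smul_one, Complex.coe_smul]

theorem operatorFunction_id (hA : IsSelfAdjoint A) : operatorFunction A id = A := cfc_id ℝ A hA

theorem operatorFunction_congr {g h : ℝ → ℝ} (hgh : Set.EqOn g h (spectrum ℝ A)) :
    operatorFunction A g = operatorFunction A h :=
  cfc_congr hgh

theorem isSelfAdjoint_operatorFunction (A : H →L[ℂ] H) (g : ℝ → ℝ) :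
    IsSelfAdjoint (operatorFunction A g) :=
  cfc_predicate g A

theorem isPositive_operatorFunction {g : ℝ → ℝ} (h : ∀ x ∈ spectrum ℝ A, 0 ≤ g x) :
    (operatorFunction A g).IsPositive :=
  (ContinuousLinearMap.nonneg_iff_isPositive _).1 (cfc_nonneg h)

/-- The operators which, together with their adjoints, map a given real subspace `R` to itself. -/
def starStabilizer (R : Submodule ℝ H) : StarSubalgebra ℝ (H →L[ℂ] H) where
  carrier := {A | (∀ u ∈ R, A u ∈ R) ∧ ∀ u ∈ R, star A u ∈ R}
  mul_mem' hA hB := ⟨fun u hu => hA.1 _ (hB.1 u hu), fun u hu => by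
    rw [star_mul]
    exact hB.2 _ (hA.2 u hu)⟩
  add_mem' hA hB := ⟨fun u hu => R.add_mem (hA.1 u hu) (hB.1 u hu), fun u hu => by
    rw [star_add]
    exact R.add_mem (hA.2 u hu) (hB.2 u hu)⟩
  algebraMap_mem' c := by
    have hc : ∀ u ∈ R, algebraMap ℝ (H →L[ℂ] H) c u ∈ R := fun u hu => by
      rw [Algebra.algebraMap_eq_smul_one]
      exact R.smul_mem c hu
    refine ⟨hc, ?_⟩
    rwa [← algebraMap_star_comm, star_trivial]
  star_mem' hA := ⟨hA.2, by simpa only [star_star] using hA.1⟩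

theorem isClosed_starStabilizer {R : Submodule ℝ H} (hR : IsClosed (R : Set H)) :
    IsClosed (starStabilizer R : Set (H →L[ℂ] H)) := by
  have : (starStabilizer R : Set (H →L[ℂ] H)) =
      ⋂ u ∈ R, {A : H →L[ℂ] H | A u ∈ R} ∩ {A : H →L[ℂ] H | star A u ∈ R} := by
    ext A
    simp only [Set.mem_iInter, Set.mem_inter_iff, forall_and]
    rfl
  rw [this]
  refine isClosed_biInter fun u _ => (hR.preimage ?_).inter (hR.preimage ?_) <;> fun_prop

theorem operatorFunction_apply_mem (hA : IsSelfAdjoint A) {R : Submodule ℝ H}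
    (hR : IsClosed (R : Set H)) (hAR : ∀ u ∈ R, A u ∈ R) (g : ℝ → ℝ) {u : H} (hu : u ∈ R) :
    operatorFunction A g u ∈ R := by
  have := isClosed_starStabilizer hR
  have hmem : A ∈ starStabilizer R := ⟨hAR, by rwa [hA.star_eq]⟩
  exact (cfc_mem (𝕜' := ℝ) (s := starStabilizer R) g hmem).1 u hu

end OperatorFunction

namespace WeightedGraph

open scoped MatrixOrder Matrix.Norms.L2Operator

section Sequences

variable {G : Type*}

theorem delta_eq_single [DecidableEq G] (i : G) : delta i = lp.single 2 i (1 : ℂ) := by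
  rw [delta, Subsingleton.elim (Classical.decEq G)]

theorem delta_apply [DecidableEq G] (i j : G) : delta i j = if j = i then (1 : ℂ) else 0 := by
  rw [delta_eq_single, lp.single_apply, Pi.single_apply]

theorem norm_delta (i : G) : ‖delta i‖ = 1 := by
  classical
  rw [delta_eq_single, lp.norm_single (by norm_num), norm_one]

variable (G) in
/-- The real subspace of the real-valued sequences of `ℓ²(G)`. -/
def realSequences : Submodule ℝ (lp (fun _ : G => ℂ) 2) where
  carrier := {u | ∀ i, (u i).im = 0}
  zero_mem' _ := rfl
  add_mem' hu hv i := by simp [hu i, hv i]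
  smul_mem' c u hu i := by simp [hu i]

theorem delta_mem_realSequences (i : G) : delta i ∈ realSequences G := fun j => by
  classical
  rw [delta_apply]
  split_ifs <;> simp

theorem isClosed_realSequences : IsClosed (realSequences G : Set (lp (fun _ : G => ℂ) 2)) := by
  have : (realSequences G : Set (lp (fun _ : G => ℂ) 2)) =
      ⋂ i : G, {u | (inner ℂ (delta i) u).im = 0} := by
    ext u
    simp only [Set.mem_iInter, inner_delta]
    rfl
  rw [this]
  exact isClosed_iInter fun i => isClosed_eq (by fun_prop) continuous_const

/-- The finitely supported sequence with values `x` on `S`. -/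
noncomputable def extend (S : Finset G) (x : S → ℝ) : lp (fun _ : G => ℂ) 2 :=
  ∑ i : S, (x i : ℂ) • delta (i : G)

theorem inner_extend (S : Finset G) (x : S → ℝ) (u : lp (fun _ : G => ℂ) 2) :
    inner ℂ (extend S x) u = ∑ i : S, (x i : ℂ) * u i := by
  simp [extend, inner_delta]

theorem extend_apply [DecidableEq G] (S : Finset G) (x : S → ℝ) (i : G) :
    extend S x i = if h : i ∈ S then (x ⟨i, h⟩ : ℂ) else 0 := by
  simp only [extend, lp.coeFn_sum, Finset.sum_apply, lp.coeFn_smul, Pi.smul_apply, delta_apply,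
    smul_eq_mul, mul_ite, mul_one, mul_zero]
  split_ifs with h
  · rw [Finset.sum_eq_single ⟨i, h⟩ (fun j _ hj => if_neg fun hij => hj (Subtype.ext hij.symm))
      (by simp), if_pos rfl]
  · exact Finset.sum_eq_zero fun j _ => if_neg fun hij => h (by simp [hij])

theorem norm_extend (S : Finset G) (x : S → ℝ) : ‖extend S x‖ = ‖WithLp.toLp 2 x‖ := by
  classical
  have h : inner ℂ (extend S x) (extend S x) = ((x ⬝ᵥ x : ℝ) : ℂ) := by
    rw [inner_extend]
    simp [extend_apply, dotProduct]
  rw [← sq_eq_sq₀ (norm_nonneg _) (norm_nonneg _), ← dotProduct_self_eq_norm_sq,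
    ← inner_self_eq_norm_sq (𝕜 := ℂ), h]
  exact RCLike.ofReal_re _

theorem sum_norm_sq_apply_le (S : Finset G) (u : lp (fun _ : G => ℂ) 2) :
    ∑ i : S, ‖u i‖ ^ 2 ≤ ‖u‖ ^ 2 := by
  have := lp.sum_rpow_le_norm_rpow (p := 2) (by norm_num) u S
  simp only [ENNReal.toReal_ofNat, Real.rpow_ofNat] at this
  rwa [Finset.sum_coe_sort S fun i => ‖u i‖ ^ 2]

end Sequences

variable {G : Type*} (Γ : WeightedGraph G)

theorem norm_op_le_one : ‖Γ.op‖ ≤ 1 := LinearMap.mkContinuous_norm_le _ zero_le_one _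

theorem op_mem_realSequences {u : lp (fun _ : G => ℂ) 2} (hu : u ∈ realSequences G) :
    Γ.op u ∈ realSequences G := fun i => by
  rw [op_apply, Complex.im_tsum (Γ.summable_mul u i)]
  simp [hu _]

theorem isCompact_Sp : IsCompact Γ.Sp := spectrum.isCompact (𝕜 := ℝ) Γ.op

theorem Sp_subset_Icc : Γ.Sp ⊆ Set.Icc (-1) 1 := fun x hx => by
  have h : ‖x‖ ≤ ‖Γ.op‖ * ‖(1 : lp (fun _ : G => ℂ) 2 →L[ℂ] lp (fun _ : G => ℂ) 2)‖ :=
    spectrum.norm_le_norm_mul_of_mem hx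
  exact _root_.abs_le.1 (h.trans
    (mul_le_one₀ Γ.norm_op_le_one (norm_nonneg _) ContinuousLinearMap.norm_id_le))

theorem exists_boundedContinuous_eqOn {g : ℝ → ℝ} (hg : ContinuousOn g Γ.Sp) :
    ∃ g' : BoundedContinuousFunction ℝ ℝ, Set.EqOn g g' Γ.Sp := by
  have : CompactSpace Γ.Sp := isCompact_iff_compactSpace.1 Γ.isCompact_Sp
  obtain ⟨g', -, hg'⟩ :=
    BoundedContinuousFunction.exists_extension_norm_eq_of_isClosedEmbedding
      (BoundedContinuousFunction.mkOfCompact ⟨Γ.Sp.domRestrict g, hg.domRestrict⟩)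
      Γ.isCompact_Sp.isClosed.isClosedEmbedding_subtypeVal
  exact ⟨g', fun x hx => (congrFun hg' ⟨x, hx⟩).symm⟩

theorem exists_polynomial_near {g : ℝ → ℝ} (hg : ContinuousOn g Γ.Sp) {ε : ℝ} (hε : 0 < ε) :
    ∃ p : Polynomial ℝ, ∀ x ∈ Γ.Sp, |g x - p.eval x| ≤ ε := by
  obtain ⟨g', hg'⟩ := Γ.exists_boundedContinuous_eqOn hg
  obtain ⟨p, hp⟩ := exists_polynomial_near_of_continuousOn (-1) 1 g' g'.continuous.continuousOn ε hε
  refine ⟨p, fun x hx => ?_⟩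
  rw [hg' hx, abs_sub_comm]
  exact (hp x (Γ.Sp_subset_Icc hx)).le

theorem exists_abs_le {g : ℝ → ℝ} (hg : ContinuousOn g Γ.Sp) :
    ∃ C, 0 ≤ C ∧ ∀ x ∈ Γ.Sp, |g x| ≤ C := by
  obtain ⟨C, hC⟩ := Γ.isCompact_Sp.exists_bound_of_continuousOn hg
  exact ⟨max C 0, le_max_right _ _, fun x hx => (hC x hx).trans (le_max_left _ _)⟩

theorem operatorFunction_delta_apply (g : ℝ → ℝ) (i j : G) :
    operatorFunction Γ.op g (delta j) i = (Γ.K g i j : ℂ) := by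
  have him : (operatorFunction Γ.op g (delta j) i).im = 0 :=
    operatorFunction_apply_mem Γ.isSelfAdjoint_op isClosed_realSequences
      (fun _ => Γ.op_mem_realSequences) g (delta_mem_realSequences j) i
  rw [K, inner_delta]
  exact Complex.ext (Complex.ofReal_re _).symm (him.trans (Complex.ofReal_im _).symm)

theorem K_comm (g : ℝ → ℝ) (i j : G) : Γ.K g i j = Γ.K g j i := by
  have h : inner ℂ (operatorFunction Γ.op g (delta i)) (delta j) =
    inner ℂ (delta i) (operatorFunction Γ.op g (delta j)) :=
    (isSelfAdjoint_operatorFunction Γ.op g).isSymmetric (delta i) (delta j)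
  rw [K, K, ← h, ← inner_conj_symm, Complex.conj_re]

theorem Kmat_apply (S : Finset G) (g : ℝ → ℝ) (i j : S) : Γ.Kmat S g i j = Γ.K g i j := rfl

theorem isHermitian_Kmat (S : Finset G) (g : ℝ → ℝ) : (Γ.Kmat S g).IsHermitian := by
  ext i j
  exact Γ.K_comm g j i

theorem Kmat_congr (S : Finset G) {g h : ℝ → ℝ} (hgh : Set.EqOn g h Γ.Sp) :
    Γ.Kmat S g = Γ.Kmat S h := by
  ext i j
  simp only [Kmat_apply, K, operatorFunction_congr hgh]

theorem Kmat_add (S : Finset G) {g h : ℝ → ℝ} (hg : ContinuousOn g Γ.Sp)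
    (hh : ContinuousOn h Γ.Sp) : Γ.Kmat S (fun x => g x + h x) = Γ.Kmat S g + Γ.Kmat S h := by
  ext i j
  simp [Kmat_apply, K, operatorFunction_add hg hh]

theorem Kmat_sub (S : Finset G) {g h : ℝ → ℝ} (hg : ContinuousOn g Γ.Sp)
    (hh : ContinuousOn h Γ.Sp) : Γ.Kmat S (fun x => g x - h x) = Γ.Kmat S g - Γ.Kmat S h := by
  ext i j
  simp [Kmat_apply, K, operatorFunction_sub hg hh]

theorem Kmat_mul_const (S : Finset G) {g : ℝ → ℝ} (hg : ContinuousOn g Γ.Sp) (c : ℝ) :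
    Γ.Kmat S (fun x => g x * c) = c • Γ.Kmat S g := by
  ext i j
  simp [Kmat_apply, K, operatorFunction_mul hg continuousOn_const,
    operatorFunction_const Γ.isSelfAdjoint_op, -Complex.coe_smul]

theorem Kmat_const [DecidableEq G] (S : Finset G) (c : ℝ) : Γ.Kmat S (fun _ => c) = c • 1 := by
  ext i j
  rw [Kmat_apply, K, operatorFunction_const Γ.isSelfAdjoint_op, inner_delta,
    Matrix.smul_apply, Matrix.one_apply, smul_apply, lp.coeFn_smul, Pi.smul_apply,
    one_apply_eq_self, delta_apply]
  by_cases hij : i = j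
  · simp [hij]
  · simp [hij, Subtype.coe_injective.ne hij]

theorem Kmat_id_apply (S : Finset G) (i j : S) : Γ.Kmat S id i j = Γ.W i j := by
  rw [Kmat_apply, K, operatorFunction_id Γ.isSelfAdjoint_op, inner_delta, op_delta_apply,
    Complex.ofReal_re]

theorem operatorFunction_extend_apply (S : Finset G) (g : ℝ → ℝ) (x : S → ℝ) (i : S) :
    operatorFunction Γ.op g (extend S x) i = ((Γ.Kmat S g *ᵥ x) i : ℂ) := by
  rw [extend, map_sum, lp.coeFn_sum, Finset.sum_apply]
  simp only [map_smul, lp.coeFn_smul, Pi.smul_apply, operatorFunction_delta_apply]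
  simp [Matrix.mulVec, dotProduct, Kmat_apply, mul_comm]

theorem norm_Kmat_le [DecidableEq G] (S : Finset G) {g : ℝ → ℝ} {C : ℝ} (hC : 0 ≤ C)
    (h : ∀ x ∈ Γ.Sp, |g x| ≤ C) : ‖Γ.Kmat S g‖ ≤ C := by
  refine l2_opNorm_le_of_forall_norm_mulVec_le hC fun x => ?_
  rw [← sq_le_sq₀ (norm_nonneg _) (by positivity)]
  calc ‖WithLp.toLp 2 (Γ.Kmat S g *ᵥ x)‖ ^ 2
      = ∑ i : S, ‖operatorFunction Γ.op g (extend S x) i‖ ^ 2 := by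
        simp [operatorFunction_extend_apply, EuclideanSpace.norm_sq_eq]
    _ ≤ ‖operatorFunction Γ.op g (extend S x)‖ ^ 2 := sum_norm_sq_apply_le _ _
    _ ≤ (C * ‖extend S x‖) ^ 2 := by
        gcongr
        exact ContinuousLinearMap.le_of_opNorm_le _ (norm_operatorFunction_le hC h) _
    _ = (C * ‖WithLp.toLp 2 x‖) ^ 2 := by rw [norm_extend]

theorem norm_Kmat_sub_le [DecidableEq G] (S : Finset G) {g h : ℝ → ℝ} (hg : ContinuousOn g Γ.Sp)
    (hh : ContinuousOn h Γ.Sp) {C : ℝ} (hC : 0 ≤ C) (hgh : ∀ x ∈ Γ.Sp, |g x - h x| ≤ C) :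
    ‖Γ.Kmat S g - Γ.Kmat S h‖ ≤ C := by
  rw [← Γ.Kmat_sub S hg hh]
  exact Γ.norm_Kmat_le S hC hgh

theorem posSemidef_Kmat (S : Finset G) {g : ℝ → ℝ} (h : ∀ x ∈ Γ.Sp, 0 ≤ g x) :
    (Γ.Kmat S g).PosSemidef := by
  refine .of_dotProduct_mulVec_nonneg (Γ.isHermitian_Kmat S g) fun x => ?_
  have hinner := (isPositive_operatorFunction h).inner_nonneg_right (extend S x)
  simp only [inner_extend, operatorFunction_extend_apply] at hinner
  simp only [star_trivial, dotProduct]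
  exact_mod_cast hinner

theorem smul_one_le_Kmat [DecidableEq G] (S : Finset G) {g : ℝ → ℝ} (hg : ContinuousOn g Γ.Sp)
    {c : ℝ} (h : ∀ x ∈ Γ.Sp, c ≤ g x) : c • 1 ≤ Γ.Kmat S g := by
  rw [Matrix.le_iff, ← Kmat_const, ← Γ.Kmat_sub S hg continuousOn_const]
  exact Γ.posSemidef_Kmat S fun x hx => sub_nonneg.2 (h x hx)

end WeightedGraph

/-! ### Sequences of matrices modulo Hilbert–Schmidt-negligible ones -/

section HSNegligible

open scoped Matrix.Norms.L2Operator

variable {β : Type*} {l : Filter β} {ι : β → Type*} [∀ n, Fintype (ι n)]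
  {A B : ∀ n, Matrix (ι n) (ι n) ℝ}

/-- A family of square matrices is Hilbert–Schmidt-negligible along a filter when the squares of
the Hilbert–Schmidt norms are small with respect to the sizes. Such a perturbation does not affect
the limits of normalized traces. -/
def HSNegligible (l : Filter β) (A : ∀ n, Matrix (ι n) (ι n) ℝ) : Prop :=
  Tendsto (fun n => frobeniusSq (A n) / Fintype.card (ι n)) l (𝓝 0)

theorem HSNegligible.of_le {F : β → ℝ}
    (h : ∀ n, frobeniusSq (A n) / Fintype.card (ι n) ≤ F n) (hF : Tendsto F l (𝓝 0)) :
    HSNegligible l A :=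
  squeeze_zero (fun n => div_nonneg (frobeniusSq_nonneg (A n)) (by positivity)) h hF

theorem hsNegligible_zero : HSNegligible l fun n => (0 : Matrix (ι n) (ι n) ℝ) := by
  simpa [HSNegligible, frobeniusSq] using tendsto_const_nhds

theorem HSNegligible.add (hA : HSNegligible l A) (hB : HSNegligible l B) :
    HSNegligible l fun n => A n + B n := by
  refine .of_le (F := fun n => 2 * (frobeniusSq (A n) / Fintype.card (ι n)) +
    2 * (frobeniusSq (B n) / Fintype.card (ι n))) (fun n => ?_)
    (by simpa using (Tendsto.const_mul 2 hA).add (Tendsto.const_mul 2 hB))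
  rw [← mul_div_assoc, ← mul_div_assoc, ← add_div]
  gcongr
  exact frobeniusSq_add_le _ _

theorem HSNegligible.tendsto_trace (hA : HSNegligible l A) :
    Tendsto (fun n => (A n).trace / Fintype.card (ι n)) l (𝓝 0) := by
  have h : Tendsto (fun n => √(frobeniusSq (A n) / Fintype.card (ι n))) l (𝓝 0) := by
    simpa only [Real.sqrt_zero, Function.comp_def] using (Real.continuous_sqrt.tendsto 0).comp hA
  refine squeeze_zero_norm (fun n => Real.abs_le_sqrt ?_) h
  rcases (Fintype.card (ι n)).eq_zero_or_pos with h0 | h0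
  · simp [h0]
  · rw [div_pow, div_le_div_iff₀ (by positivity) (by positivity)]
    nlinarith [trace_sq_le (A n)]

theorem HSNegligible.tendsto_trace_of_sub (hAB : HSNegligible l fun n => A n - B n) {a : ℝ}
    (hB : Tendsto (fun n => (B n).trace / Fintype.card (ι n)) l (𝓝 a)) :
    Tendsto (fun n => (A n).trace / Fintype.card (ι n)) l (𝓝 a) := by
  have h := hAB.tendsto_trace.add hB
  rw [zero_add] at h
  exact h.congr fun n => by rw [Matrix.trace_sub, sub_div, sub_add_cancel]

variable [∀ n, DecidableEq (ι n)] {C : ℝ}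

theorem HSNegligible.mul_left (hA : ∀ n, ‖A n‖ ≤ C) (hB : HSNegligible l B) :
    HSNegligible l fun n => A n * B n := by
  refine .of_le (fun n => ?_) (by simpa using Tendsto.const_mul (C ^ 2) hB)
  rw [← mul_div_assoc]
  gcongr
  refine (frobeniusSq_mul_le_left _ _).trans ?_
  gcongr
  · exact frobeniusSq_nonneg _
  · exact hA n

theorem HSNegligible.mul_right (hA : HSNegligible l A) (hB : ∀ n, ‖B n‖ ≤ C) :
    HSNegligible l fun n => A n * B n := by
  refine .of_le (fun n => ?_) (by simpa using Tendsto.const_mul (C ^ 2) hA)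
  rw [← mul_div_assoc]
  gcongr
  refine (frobeniusSq_mul_le_right _ _).trans ?_
  gcongr
  · exact frobeniusSq_nonneg _
  · exact hB n

theorem frobeniusSq_le_card_mul_sq {n : Type*} [Fintype n] [DecidableEq n] (A : Matrix n n ℝ) :
    frobeniusSq A ≤ Fintype.card n * ‖A‖ ^ 2 := by
  simpa [frobeniusSq, Matrix.one_apply, ite_pow, mul_comm] using
    frobeniusSq_mul_le_left A (1 : Matrix n n ℝ)

theorem HSNegligible.of_forall_exists_norm_sub_le
    (h : ∀ ε > 0, ∃ B : ∀ n, Matrix (ι n) (ι n) ℝ, HSNegligible l B ∧ ∀ n, ‖A n - B n‖ ≤ ε) :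
    HSNegligible l A := by
  refine Metric.tendsto_nhds.2 fun ε hε => ?_
  obtain ⟨B, hB, hAB⟩ := h (√(ε / 4)) (by positivity)
  filter_upwards [hB.eventually_lt_const (u := ε / 4) (by positivity)] with n hn
  rw [Real.dist_0_eq_abs, abs_of_nonneg (div_nonneg (frobeniusSq_nonneg _) (by positivity))]
  have hdiff : frobeniusSq (A n - B n) ≤ Fintype.card (ι n) * (ε / 4) := by
    refine (frobeniusSq_le_card_mul_sq _).trans ?_
    gcongr
    rw [← Real.sq_sqrt (by positivity : 0 ≤ ε / 4)]
    gcongr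
    exact hAB n
  calc frobeniusSq (A n) / Fintype.card (ι n)
      ≤ (2 * (Fintype.card (ι n) * (ε / 4)) + 2 * frobeniusSq (B n)) / Fintype.card (ι n) := by
        gcongr
        conv_lhs => rw [← sub_add_cancel (A n) (B n)]
        exact (frobeniusSq_add_le _ _).trans (by gcongr)
    _ = 2 * (Fintype.card (ι n) / Fintype.card (ι n) * (ε / 4)) +
        2 * (frobeniusSq (B n) / Fintype.card (ι n)) := by ring
    _ ≤ 2 * (1 * (ε / 4)) + 2 * (frobeniusSq (B n) / Fintype.card (ι n)) := by
        gcongr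
        exact div_self_le_one _
    _ < ε := by linarith

end HSNegligible

namespace WeightedGraph

open scoped Matrix.Norms.L2Operator

section BoundaryEffects

variable {G : Type*} (Γ : WeightedGraph G)

theorem norm_op_delta_sub_extend_le (S : Finset G) (j : S) :
    ‖Γ.op (delta (j : G)) - extend S fun k => Γ.W k j‖ ≤ 2 := by
  classical
  have hcol : (fun k : S => Γ.W k j) = Γ.Kmat S id *ᵥ Pi.single j 1 := by
    ext k
    simp [Kmat_id_apply]
  have hext : ‖extend S fun k => Γ.W k j‖ ≤ 1 := by
    rw [norm_extend, hcol]
    refine (Matrix.l2_opNorm_mulVec (Γ.Kmat S id) (WithLp.toLp 2 (Pi.single j 1))).trans ?_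
    rw [PiLp.toLp_single, PiLp.norm_single, norm_one, mul_one]
    exact Γ.norm_Kmat_le S zero_le_one fun x hx => _root_.abs_le.2 (Γ.Sp_subset_Icc hx)
  have hop : ‖Γ.op (delta (j : G))‖ ≤ 1 := by
    simpa [norm_delta] using Γ.op.le_of_opNorm_le Γ.norm_op_le_one (delta (j : G))
  linarith [norm_sub_le (Γ.op (delta (j : G))) (extend S fun k => Γ.W k j)]

theorem op_delta_eq_extend {S : Finset G} (j : S) (hj : ∀ k ∉ S, Γ.W j k = 0) :
    Γ.op (delta (j : G)) = extend S fun k => Γ.W k j := by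
  classical
  ext k
  rw [op_delta_apply, extend_apply]
  split_ifs with hk
  · rfl
  · rw [Γ.symm, hj k hk, Complex.ofReal_zero]

theorem sum_norm_op_delta_sub_extend_sq_le (S : Finset G) :
    ∑ j : S, ‖Γ.op (delta (j : G)) - extend S fun k => Γ.W k j‖ ^ 2 ≤
      4 * Γ.boundaryCard S := by
  classical
  have hcard : (Γ.boundaryCard S : ℝ) =
      ∑ j : S, if ∃ k, k ∉ S ∧ Γ.W j k ≠ 0 then (1 : ℝ) else 0 := by
    rw [Finset.sum_coe_sort S fun j => if ∃ k, k ∉ S ∧ Γ.W j k ≠ 0 then (1 : ℝ) else 0,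
      Finset.sum_boole, ← Set.ncard_coe_finset, Finset.coe_filter, boundaryCard]
  rw [hcard, Finset.mul_sum]
  refine Finset.sum_le_sum fun j _ => ?_
  split_ifs with hj
  · nlinarith [Γ.norm_op_delta_sub_extend_le S j,
      norm_nonneg (Γ.op (delta (j : G)) - extend S fun k => Γ.W k j)]
  · push Not at hj
    simp [Γ.op_delta_eq_extend j hj]

theorem Kmat_mul_id_sub_apply (S : Finset G) {g : ℝ → ℝ} (hg : ContinuousOn g Γ.Sp) (i j : S) :
    (((Γ.Kmat S g * Γ.Kmat S id - Γ.Kmat S fun x => g x * x) i j : ℝ) : ℂ) =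
      -operatorFunction Γ.op g (Γ.op (delta (j : G)) - extend S fun k => Γ.W k j) i := by
  have hmul : operatorFunction Γ.op g (Γ.op (delta (j : G))) =
      operatorFunction Γ.op (fun x => g x * x) (delta (j : G)) := by
    have := operatorFunction_mul hg continuousOn_id
    rw [operatorFunction_id Γ.isSelfAdjoint_op] at this
    exact (DFunLike.congr_fun this (delta (j : G))).symm
  rw [map_sub, lp.coeFn_sub, Pi.sub_apply, hmul, operatorFunction_delta_apply,
    operatorFunction_extend_apply]
  simp only [← Kmat_apply, Matrix.sub_apply, Matrix.mul_apply, Kmat_id_apply, Matrix.mulVec,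
    dotProduct]
  push_cast
  ring

theorem frobeniusSq_Kmat_mul_id_sub_le (S : Finset G) {g : ℝ → ℝ} (hg : ContinuousOn g Γ.Sp)
    {C : ℝ} (hC : 0 ≤ C) (hgC : ∀ x ∈ Γ.Sp, |g x| ≤ C) :
    frobeniusSq (Γ.Kmat S g * Γ.Kmat S id - Γ.Kmat S fun x => g x * x) ≤
      C ^ 2 * (4 * Γ.boundaryCard S) := by
  refine le_trans ?_ (mul_le_mul_of_nonneg_left (Γ.sum_norm_op_delta_sub_extend_sq_le S)
    (sq_nonneg C))
  rw [frobeniusSq, Finset.sum_comm, Finset.mul_sum]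
  refine Finset.sum_le_sum fun j _ => ?_
  set u := Γ.op (delta (j : G)) - extend S fun k => Γ.W k j
  calc _ = ∑ i : S, ‖operatorFunction Γ.op g u i‖ ^ 2 := by
        refine Finset.sum_congr rfl fun i _ => ?_
        rw [← norm_neg, ← Γ.Kmat_mul_id_sub_apply S hg, Complex.norm_real, Real.norm_eq_abs, sq_abs]
    _ ≤ ‖operatorFunction Γ.op g u‖ ^ 2 := sum_norm_sq_apply_le _ _
    _ ≤ (C * ‖u‖) ^ 2 := by
        gcongr
        exact ContinuousLinearMap.le_of_opNorm_le _ (norm_operatorFunction_le hC hgC) _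
    _ = C ^ 2 * ‖u‖ ^ 2 := mul_pow _ _ _

/-- The boundaries of the sets of vertices `V n` are small with respect to the sets along `l`. -/
def IsFolner {β : Type*} (l : Filter β) (V : β → Finset G) : Prop :=
  (fun n => (Γ.boundaryCard (V n) : ℝ)) =o[l] fun n => ((V n).card : ℝ)

variable {Γ} {β : Type*} {l : Filter β} {V : β → Finset G} {f g h : ℝ → ℝ}

theorem IsFolner.hsNegligible_Kmat_mul_id (hV : Γ.IsFolner l V) (hg : ContinuousOn g Γ.Sp) :
    HSNegligible l fun n => Γ.Kmat (V n) g * Γ.Kmat (V n) id - Γ.Kmat (V n) fun x => g x * x := by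
  obtain ⟨C, hC, hgC⟩ := Γ.exists_abs_le hg
  refine .of_le (F := fun n => C ^ 2 * 4 * ((Γ.boundaryCard (V n) : ℝ) / (V n).card)) (fun n => ?_)
    (by simpa using hV.tendsto_div_nhds_zero.const_mul (C ^ 2 * 4))
  rw [Fintype.card_coe, ← mul_div_assoc, mul_assoc]
  gcongr
  exact Γ.frobeniusSq_Kmat_mul_id_sub_le (V n) hg hC hgC

theorem exists_norm_Kmat_le [DecidableEq G] (V : β → Finset G) (hg : ContinuousOn g Γ.Sp) :
    ∃ C, ∀ n, ‖Γ.Kmat (V n) g‖ ≤ C := by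
  obtain ⟨C, hC, hgC⟩ := Γ.exists_abs_le hg
  exact ⟨C, fun n => Γ.norm_Kmat_le (V n) hC hgC⟩

theorem IsFolner.hsNegligible_Kmat_mul_mul_id (hV : Γ.IsFolner l V) (hg : ContinuousOn g Γ.Sp)
    (hh : ContinuousOn h Γ.Sp)
    (hgh : HSNegligible l fun n =>
      Γ.Kmat (V n) g * Γ.Kmat (V n) h - Γ.Kmat (V n) fun x => g x * h x) :
    HSNegligible l fun n => Γ.Kmat (V n) g * Γ.Kmat (V n) (fun x => h x * x) -
      Γ.Kmat (V n) fun x => g x * (h x * x) := by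
  classical
  obtain ⟨C, hC⟩ := exists_norm_Kmat_le V hg
  obtain ⟨D, hD⟩ := exists_norm_Kmat_le V (continuousOn_id (s := Γ.Sp))
  have h₁ := (hV.hsNegligible_Kmat_mul_id hh).mul_left (A := fun n => -Γ.Kmat (V n) g)
    fun n => by simpa using hC n
  have h₂ := hgh.mul_right hD
  have h₃ := hV.hsNegligible_Kmat_mul_id (hg.fun_mul hh)
  convert (h₁.add h₂).add h₃ using 2 with n
  noncomm_ring

theorem IsFolner.hsNegligible_Kmat_mul_eval (hV : Γ.IsFolner l V) (hg : ContinuousOn g Γ.Sp)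
    (p : Polynomial ℝ) :
    HSNegligible l fun n => Γ.Kmat (V n) g * Γ.Kmat (V n) (fun x => p.eval x) -
      Γ.Kmat (V n) fun x => g x * p.eval x := by
  classical
  have hgp (q : Polynomial ℝ) : ContinuousOn (fun x => g x * q.eval x) Γ.Sp :=
    hg.mul q.continuousOn
  induction p using Polynomial.induction_on with
  | C a =>
    convert hsNegligible_zero (ι := fun n => V n) using 2 with n
    simp only [Polynomial.eval_C]
    rw [Kmat_mul_const _ _ hg, Kmat_const, Matrix.mul_smul, mul_one, sub_self]
  | add p q hp hq =>
    convert hp.add hq using 2 with n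
    simp only [Polynomial.eval_add, mul_add]
    rw [Kmat_add _ _ p.continuousOn q.continuousOn, Kmat_add _ _ (hgp p) (hgp q), mul_add]
    abel
  | monomial k a ih =>
    simpa [pow_succ, ← mul_assoc] using
      hV.hsNegligible_Kmat_mul_mul_id hg (Polynomial.continuousOn _) ih

theorem IsFolner.hsNegligible_Kmat_mul (hV : Γ.IsFolner l V) (hg : ContinuousOn g Γ.Sp)
    (hh : ContinuousOn h Γ.Sp) :
    HSNegligible l fun n =>
      Γ.Kmat (V n) g * Γ.Kmat (V n) h - Γ.Kmat (V n) fun x => g x * h x := by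
  classical
  obtain ⟨C, hC, hgC⟩ := Γ.exists_abs_le hg
  refine .of_forall_exists_norm_sub_le fun ε hε => ?_
  set η := ε / (2 * (C + 1))
  have hη : 0 < η := by positivity
  obtain ⟨p, hp⟩ := Γ.exists_polynomial_near hh hη
  refine ⟨_, hV.hsNegligible_Kmat_mul_eval hg p, fun n => ?_⟩
  have hmul : ‖Γ.Kmat (V n) g * (Γ.Kmat (V n) h - Γ.Kmat (V n) fun x => p.eval x)‖ ≤ C * η :=
    (norm_mul_le _ _).trans (by
      gcongr
      exacts [Γ.norm_Kmat_le _ hC hgC, Γ.norm_Kmat_sub_le _ hh p.continuousOn hη.le hp])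
  have hprod : ‖(Γ.Kmat (V n) fun x => g x * h x) - Γ.Kmat (V n) fun x => g x * p.eval x‖ ≤
      C * η := by
    refine Γ.norm_Kmat_sub_le _ (hg.fun_mul hh) (hg.fun_mul p.continuousOn) (by positivity)
      fun x hx => ?_
    rw [← mul_sub, abs_mul]
    gcongr
    exacts [hgC x hx, hp x hx]
  calc _ = ‖Γ.Kmat (V n) g * (Γ.Kmat (V n) h - Γ.Kmat (V n) fun x => p.eval x) -
        ((Γ.Kmat (V n) fun x => g x * h x) - Γ.Kmat (V n) fun x => g x * p.eval x)‖ := by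
        congr 1
        noncomm_ring
    _ ≤ C * η + C * η := (norm_sub_le _ _).trans (add_le_add hmul hprod)
    _ ≤ 2 * (C + 1) * η := by nlinarith
    _ = ε := mul_div_cancel₀ _ (by positivity)

theorem IsFolner.hsNegligible_aeval_Kmat [DecidableEq G] (hV : Γ.IsFolner l V)
    (hg : ContinuousOn g Γ.Sp) (p : Polynomial ℝ) :
    HSNegligible l fun n =>
      Polynomial.aeval (Γ.Kmat (V n) g) p - Γ.Kmat (V n) fun x => p.eval (g x) := by
  have hpg (q : Polynomial ℝ) : ContinuousOn (fun x => q.eval (g x)) Γ.Sp :=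
    q.continuous.comp_continuousOn hg
  obtain ⟨C, hC⟩ := exists_norm_Kmat_le V hg
  induction p using Polynomial.induction_on with
  | C a =>
    convert hsNegligible_zero (ι := fun n => V n) using 2 with n
    simp [Kmat_const, Algebra.algebraMap_eq_smul_one]
  | add p q hp hq =>
    convert hp.add hq using 2 with n
    simp only [Polynomial.eval_add, map_add]
    rw [Kmat_add _ _ (hpg p) (hpg q)]
    abel
  | monomial k a ih =>
    convert (ih.mul_right hC).add
      (hV.hsNegligible_Kmat_mul (hpg (Polynomial.C a * Polynomial.X ^ k)) hg) using 2 with n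
    simp [pow_succ, ← mul_assoc, sub_mul]

theorem IsFolner.hsNegligible_Kmat_inv [DecidableEq G] (hV : Γ.IsFolner l V)
    (hf : ContinuousOn f Γ.Sp) (hpos : ∀ x ∈ Γ.Sp, 0 < f x) :
    HSNegligible l fun n => (Γ.Kmat (V n) f)⁻¹ - Γ.Kmat (V n) fun x => 1 / f x := by
  obtain ⟨c, hc, hcf⟩ := Γ.isCompact_Sp.exists_forall_le' hf hpos
  have hf₀ : ∀ x ∈ Γ.Sp, f x ≠ 0 := fun x hx => (hpos x hx).ne'
  have hinv (n : β) : ‖-(Γ.Kmat (V n) f)⁻¹‖ ≤ c⁻¹ := by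
    rw [norm_neg]
    exact norm_inv_le_of_smul_one_le hc (Γ.smul_one_le_Kmat (V n) hf hcf)
  have hdet (n : β) : IsUnit (Γ.Kmat (V n) f).det :=
    (posDef_of_smul_one_le hc (Γ.smul_one_le_Kmat (V n) hf hcf)).det_pos.ne'.isUnit
  have hone (n : β) : (Γ.Kmat (V n) fun x => f x * (1 / f x)) = 1 := by
    rw [Γ.Kmat_congr (V n) (h := fun _ => 1) fun x hx => mul_one_div_cancel (hf₀ x hx), Kmat_const,
      one_smul]
  convert (hV.hsNegligible_Kmat_mul hf (h := fun x => 1 / f x)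
    (continuousOn_const.div hf hf₀)).mul_left hinv using 2 with n
  rw [hone, mul_sub, mul_one, neg_mul, ← mul_assoc, Matrix.nonsing_inv_mul _ (hdet n), one_mul]
  abel

end BoundaryEffects

end WeightedGraph

/-! ### Spectral measures and normalized traces -/

theorem ae_mem_of_tendsto_finiteMeasure {Ω β : Type*} [MeasurableSpace Ω] [TopologicalSpace Ω]
    [HasOuterApproxClosed Ω] [OpensMeasurableSpace Ω] {l : Filter β} [l.NeBot]
    {ν : β → FiniteMeasure Ω} {μ : FiniteMeasure Ω} (hν : Tendsto ν l (𝓝 μ)) {F : Set Ω}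
    (hF : IsClosed F) (h : ∀ n, ∀ᵐ x ∂(ν n : Measure Ω), x ∈ F) :
    ∀ᵐ x ∂(μ : Measure Ω), x ∈ F := by
  have huniv : Tendsto (fun n => (ν n : Measure Ω) F) l (𝓝 ((μ : Measure Ω) Set.univ)) := by
    have hfull : ∀ n, (ν n : Measure Ω) F = (ν n : Measure Ω) Set.univ := fun n =>
      measure_congr (eventuallyEq_univ.2 (h n))
    simp only [hfull]
    simpa [Function.comp_def] using (ENNReal.continuous_coe.tendsto _).comp hν.mass
  have hle := FiniteMeasure.limsup_measure_closed_le_of_tendsto hν hF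
  rw [huniv.limsup_eq] at hle
  exact (ae_iff_measure_eq (p := (· ∈ F)) hF.measurableSet.nullMeasurableSet).2
    ((measure_mono (Set.subset_univ F)).antisymm hle)

theorem tendsto_of_forall_exists_approx {β : Type*} {l : Filter β} {u : β → ℝ} {a : ℝ}
    (h : ∀ ε > 0, ∃ v : β → ℝ, ∃ b, Tendsto v l (𝓝 b) ∧ (∀ᶠ n in l, |u n - v n| ≤ ε) ∧
      |b - a| ≤ ε) : Tendsto u l (𝓝 a) := by
  refine Metric.tendsto_nhds.2 fun ε hε => ?_
  obtain ⟨v, b, hv, huv, hba⟩ := h (ε / 4) (by positivity)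
  filter_upwards [huv, Metric.tendsto_nhds.1 hv (ε / 4) (by positivity)] with n hn hn'
  rw [Real.dist_eq] at hn' ⊢
  linarith [abs_sub_le (u n) (v n) a, abs_sub_le (v n) b a]

section SpectralMeasure

variable {H : Type*} [NormedAddCommGroup H] [InnerProductSpace ℂ H] [CompleteSpace H]

theorem ae_mem_spectrum_spectralMeasure (A : H →L[ℂ] H) (hA : IsSelfAdjoint A) (v : H) :
    ∀ᵐ x ∂spectralMeasure A hA v, x ∈ spectrum ℝ A :=
  (ae_map_iff measurable_subtype_coe.aemeasurable
    (spectrum.isCompact (𝕜 := ℝ) A).isClosed.measurableSet).2 (.of_forall fun x => x.2)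

theorem integral_spectralMeasure (A : H →L[ℂ] H) (hA : IsSelfAdjoint A) (v : H) {g : ℝ → ℝ}
    (hg : Continuous g) :
    ∫ x, g x ∂spectralMeasure A hA v = (inner ℂ v (operatorFunction A g v)).re := by
  have : CompactSpace (spectrum ℝ A) := isCompact_iff_compactSpace.1 (spectrum.isCompact (𝕜 := ℝ) A)
  let φ : C_c(spectrum ℝ A, ℝ) :=
    ⟨⟨fun x => g x, hg.comp continuous_subtype_val⟩, HasCompactSupport.of_compactSpace _⟩
  rw [spectralMeasure, integral_map measurable_subtype_coe.aemeasurable hg.aestronglyMeasurable,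
    operatorFunction, cfc_apply g A hA hg.continuousOn]
  exact RealRMK.integral_rieszMeasure (spectralFunctional A hA v) φ

end SpectralMeasure

namespace WeightedGraph

open scoped Matrix.Norms.L2Operator

variable {G : Type*} (Γ : WeightedGraph G)

theorem toMeasure_avgMeasure (S : Finset G) :
    (Γ.avgMeasure S : Measure ℝ) = (S.card : ℝ≥0)⁻¹ • ∑ i ∈ S,
      spectralMeasure Γ.op Γ.isSelfAdjoint_op (delta i) := by
  rw [avgMeasure, FiniteMeasure.toMeasure_smul, FiniteMeasure.toMeasure_sum]
  rfl

theorem trace_Kmat_div_card (S : Finset G) (g : BoundedContinuousFunction ℝ ℝ) :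
    (Γ.Kmat S g).trace / S.card = ∫ x, g x ∂(Γ.avgMeasure S : Measure ℝ) := by
  rw [toMeasure_avgMeasure, integral_smul_nnreal_measure,
    integral_finsetSum_measure fun i _ => g.integrable _]
  simp only [integral_spectralMeasure _ _ _ g.continuous]
  rw [div_eq_inv_mul, NNReal.smul_def, smul_eq_mul, Matrix.trace]
  simp only [Matrix.diag_apply, Kmat_apply]
  rw [Finset.sum_coe_sort S fun i => Γ.K g i i]
  simp [K]

theorem ae_mem_Sp_avgMeasure (S : Finset G) : ∀ᵐ x ∂(Γ.avgMeasure S : Measure ℝ), x ∈ Γ.Sp := by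
  rw [toMeasure_avgMeasure]
  refine Measure.ae_smul_measure ?_ _
  rw [ae_iff, Measure.finsetSum_apply]
  exact Finset.sum_eq_zero fun i _ => ae_mem_spectrum_spectralMeasure _ _ _

variable {Γ} {β : Type*} {l : Filter β} [l.NeBot] {V : β → Finset G} {μ : FiniteMeasure ℝ}
  {f g h : ℝ → ℝ}

theorem ae_mem_Sp (hμ : Tendsto (fun n => Γ.avgMeasure (V n)) l (𝓝 μ)) :
    ∀ᵐ x ∂(μ : Measure ℝ), x ∈ Γ.Sp :=
  ae_mem_of_tendsto_finiteMeasure hμ Γ.isCompact_Sp.isClosed fun n => Γ.ae_mem_Sp_avgMeasure (V n)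

theorem integrable_of_continuousOn_Sp (hμ : Tendsto (fun n => Γ.avgMeasure (V n)) l (𝓝 μ))
    (hg : ContinuousOn g Γ.Sp) : Integrable g (μ : Measure ℝ) := by
  obtain ⟨g', hg'⟩ := Γ.exists_boundedContinuous_eqOn hg
  refine (g'.integrable (μ : Measure ℝ)).congr ?_
  filter_upwards [ae_mem_Sp hμ] with x hx using (hg' hx).symm

theorem tendsto_trace_Kmat (hμ : Tendsto (fun n => Γ.avgMeasure (V n)) l (𝓝 μ))
    (hg : ContinuousOn g Γ.Sp) :
    Tendsto (fun n => (Γ.Kmat (V n) g).trace / (V n).card) l (𝓝 (∫ x, g x ∂(μ : Measure ℝ))) := by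
  obtain ⟨g', hg'⟩ := Γ.exists_boundedContinuous_eqOn hg
  have hint : ∫ x, g x ∂(μ : Measure ℝ) = ∫ x, g' x ∂(μ : Measure ℝ) :=
    integral_congr_ae <| by filter_upwards [ae_mem_Sp hμ] with x hx using hg' hx
  simp only [Γ.Kmat_congr _ hg', trace_Kmat_div_card, hint]
  exact FiniteMeasure.tendsto_iff_forall_integral_tendsto.1 hμ g'

theorem tendsto_trace_of_hsNegligible_sub_Kmat {A : ∀ n, Matrix (V n) (V n) ℝ}
    (hμ : Tendsto (fun n => Γ.avgMeasure (V n)) l (𝓝 μ)) (hg : ContinuousOn g Γ.Sp)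
    (hA : HSNegligible l fun n => A n - Γ.Kmat (V n) g) :
    Tendsto (fun n => (A n).trace / (V n).card) l (𝓝 (∫ x, g x ∂(μ : Measure ℝ))) := by
  simpa using hA.tendsto_trace_of_sub (by simpa using tendsto_trace_Kmat hμ hg)

theorem IsFolner.tendsto_trace_Kmat_mul (hV : Γ.IsFolner l V)
    (hμ : Tendsto (fun n => Γ.avgMeasure (V n)) l (𝓝 μ)) (hg : ContinuousOn g Γ.Sp)
    (hh : ContinuousOn h Γ.Sp) :
    Tendsto (fun n => (Γ.Kmat (V n) g * Γ.Kmat (V n) h).trace / (V n).card) l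
      (𝓝 (∫ x, g x * h x ∂(μ : Measure ℝ))) :=
  tendsto_trace_of_hsNegligible_sub_Kmat hμ (hg.fun_mul hh) (hV.hsNegligible_Kmat_mul hg hh)

theorem IsFolner.tendsto_trace_Kmat_inv_mul [DecidableEq G] (hV : Γ.IsFolner l V)
    (hμ : Tendsto (fun n => Γ.avgMeasure (V n)) l (𝓝 μ)) (hf : ContinuousOn f Γ.Sp)
    (hpos : ∀ x ∈ Γ.Sp, 0 < f x) (hh : ContinuousOn h Γ.Sp) :
    Tendsto (fun n => ((Γ.Kmat (V n) f)⁻¹ * Γ.Kmat (V n) h).trace / (V n).card) l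
      (𝓝 (∫ x, 1 / f x * h x ∂(μ : Measure ℝ))) := by
  have hinv : ContinuousOn (fun x => 1 / f x) Γ.Sp :=
    continuousOn_const.div hf fun x hx => (hpos x hx).ne'
  obtain ⟨C, hC⟩ := exists_norm_Kmat_le V hh
  refine tendsto_trace_of_hsNegligible_sub_Kmat hμ (hinv.fun_mul hh) ?_
  convert ((hV.hsNegligible_Kmat_inv hf hpos).mul_right hC).add
    (hV.hsNegligible_Kmat_mul hinv hh) using 2 with n
  rw [sub_mul, sub_add_sub_cancel]

theorem IsFolner.tendsto_log_det_Kmat [DecidableEq G] (hV : Γ.IsFolner l V)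
    (hμ : Tendsto (fun n => Γ.avgMeasure (V n)) l (𝓝 μ)) (hf : ContinuousOn f Γ.Sp)
    (hpos : ∀ x ∈ Γ.Sp, 0 < f x) :
    Tendsto (fun n => Real.log (Γ.Kmat (V n) f).det / (V n).card) l
      (𝓝 (∫ x, Real.log (f x) ∂(μ : Measure ℝ))) := by
  obtain ⟨c, hc, hcf⟩ := Γ.isCompact_Sp.exists_forall_le' hf hpos
  obtain ⟨C, hC, hfC⟩ := Γ.exists_abs_le hf
  have hmem : ∀ x ∈ Γ.Sp, f x ∈ Set.Icc c C := fun x hx =>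
    ⟨hcf x hx, (le_abs_self _).trans (hfC x hx)⟩
  refine tendsto_of_forall_exists_approx fun ε hε => ?_
  set M := (μ : Measure ℝ).real Set.univ
  have hM : 0 ≤ M := measureReal_nonneg
  set η := ε / (1 + M)
  have hη : 0 < η := by positivity
  have hηM : η * (1 + M) = ε := div_mul_cancel₀ _ (by positivity)
  obtain ⟨p, hp⟩ := exists_polynomial_near_of_continuousOn c C Real.log
    (Real.continuousOn_log.mono fun x hx => (hc.trans_le hx.1).ne') η hη
  have hp' : ∀ t ∈ Set.Icc c C, |Real.log t - p.eval t| ≤ η := fun t ht =>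
    (abs_sub_comm _ _).trans_le (hp t ht).le
  have hpf : ContinuousOn (fun x => p.eval (f x)) Γ.Sp := p.continuous.comp_continuousOn hf
  refine ⟨_, _, tendsto_trace_of_hsNegligible_sub_Kmat hμ hpf (hV.hsNegligible_aeval_Kmat hf p),
    .of_forall fun n => ?_, ?_⟩
  · have h := abs_log_det_sub_trace_aeval_le hc (Γ.smul_one_le_Kmat (V n) hf hcf)
      (Γ.norm_Kmat_le (V n) hC hfC) hp'
    rw [Fintype.card_coe, mul_comm] at h
    rw [← sub_div, abs_div, Nat.abs_cast]
    exact (div_le_of_le_mul₀ (by positivity) hη.le h).trans (by nlinarith)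
  · rw [← integral_sub (integrable_of_continuousOn_Sp hμ hpf)
      (integrable_of_continuousOn_Sp hμ (hf.log fun x hx => (hpos x hx).ne')), ← Real.norm_eq_abs]
    refine (norm_integral_le_of_norm_le_const (C := η) ?_).trans (by nlinarith)
    filter_upwards [ae_mem_Sp hμ] with x hx using (hp _ (hmem x hx)).le

end WeightedGraph

/-! ### Gaussian quadratic forms -/

theorem exp_neg_mul_inv_sqrt_le {s : ℝ} (hs : |s| ≤ 1 / 4) :
    Real.exp (-s) * (√(1 - 2 * s))⁻¹ ≤ Real.exp (4 * s ^ 2) := by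
  have hpos : 0 < 1 - 2 * s := by linarith [(abs_le.1 hs).2]
  have habs : |2 * s| ≤ 1 / 2 := by rw [abs_mul, abs_two]; linarith
  have htaylor : |2 * s + Real.log (1 - 2 * s)| ≤ |2 * s| ^ 2 / (1 - |2 * s|) := by
    simpa using Real.abs_log_sub_add_sum_range_le (x := 2 * s) (by linarith) 1
  have hrem : |2 * s| ^ 2 / (1 - |2 * s|) ≤ 8 * s ^ 2 := by
    rw [div_le_iff₀ (by linarith), sq_abs]
    nlinarith [sq_nonneg s]
  have hsqrt : Real.exp (-s - 4 * s ^ 2) ≤ √(1 - 2 * s) := by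
    refine Real.le_sqrt_of_sq_le ?_
    rw [← Real.exp_nat_mul, ← Real.le_log_iff_exp_le hpos]
    push_cast
    linarith [(abs_le.1 (htaylor.trans hrem)).1]
  rw [← div_eq_mul_inv, div_le_iff₀ (Real.sqrt_pos.2 hpos)]
  calc Real.exp (-s) = Real.exp (4 * s ^ 2) * Real.exp (-s - 4 * s ^ 2) := by
        rw [← Real.exp_add]; ring_nf
    _ ≤ Real.exp (4 * s ^ 2) * √(1 - 2 * s) := by gcongr

theorem integral_exp_mul_sq_sub_one_gaussianReal {s : ℝ} (hs : s < 1 / 2) :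
    ∫ x, Real.exp (s * (x ^ 2 - 1)) ∂gaussianReal 0 1 = Real.exp (-s) * (√(1 - 2 * s))⁻¹ := by
  have hdensity (x : ℝ) : gaussianPDFReal 0 1 x * Real.exp (s * (x ^ 2 - 1)) =
      (√(2 * Real.pi))⁻¹ * Real.exp (-s) * Real.exp (-(1 / 2 - s) * x ^ 2) := by
    rw [gaussianPDFReal_def]
    simp only [NNReal.coe_one, mul_one, sub_zero]
    rw [mul_assoc, mul_assoc, ← Real.exp_add, ← Real.exp_add]
    ring_nf
  have hscale : Real.pi / (1 / 2 - s) = 2 * Real.pi / (1 - 2 * s) := by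
    rw [div_eq_div_iff (by linarith) (by linarith)]
    ring
  rw [integral_gaussianReal_eq_integral_smul one_ne_zero]
  simp only [smul_eq_mul, hdensity]
  rw [integral_const_mul, integral_gaussian, hscale, Real.sqrt_div (by positivity)]
  field_simp

section QuadraticForm

open Matrix
open scoped MatrixOrder Matrix.Norms.L2Operator

variable {ι : Type*} [Fintype ι] [DecidableEq ι] {M : Matrix ι ι ℝ}

theorem dotProduct_mulVec_sum_smul_eigenvectorBasis (hM : M.IsHermitian) (y : ι → ℝ) :
    (∑ i, y i • hM.eigenvectorBasis i).ofLp ⬝ᵥ M *ᵥ (∑ i, y i • hM.eigenvectorBasis i).ofLp =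
      ∑ i, hM.eigenvalues i * y i ^ 2 := by
  have hmul : M *ᵥ (∑ i, y i • hM.eigenvectorBasis i).ofLp =
      (∑ i, (hM.eigenvalues i * y i) • hM.eigenvectorBasis i).ofLp := by
    simp only [WithLp.ofLp_sum, WithLp.ofLp_smul, mulVec_sum, mulVec_smul,
      hM.mulVec_eigenvectorBasis, smul_smul, mul_comm (y _)]
  rw [hmul, dotProduct_comm]
  refine (hM.eigenvectorBasis.orthonormal.inner_sum y _ Finset.univ).trans ?_
  exact Finset.sum_congr rfl fun i _ => by rw [RCLike.conj_to_real]; ring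

theorem mgf_quadratic_stdGaussian (hM : M.IsHermitian) {t : ℝ}
    (ht : ∀ i, t * hM.eigenvalues i < 1 / 2) :
    mgf (fun x : EuclideanSpace ℝ ι => x.ofLp ⬝ᵥ M *ᵥ x.ofLp - M.trace) (stdGaussian _) t =
      ∏ i, (Real.exp (-(t * hM.eigenvalues i)) * (√(1 - 2 * (t * hM.eigenvalues i)))⁻¹) := by
  rw [mgf, stdGaussian_eq_map_pi_orthonormalBasis hM.eigenvectorBasis,
    integral_map (Measurable.aemeasurable (by fun_prop)) (by fun_prop)]
  have hexp (y : ι → ℝ) : Real.exp (t * ((∑ i, y i • hM.eigenvectorBasis i).ofLp ⬝ᵥ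
      M *ᵥ (∑ i, y i • hM.eigenvectorBasis i).ofLp - M.trace)) =
      ∏ i, Real.exp (t * hM.eigenvalues i * (y i ^ 2 - 1)) := by
    rw [dotProduct_mulVec_sum_smul_eigenvectorBasis, hM.trace_eq_sum_eigenvalues, ← Real.exp_sum,
      RCLike.ofReal_real_eq_id]
    simp only [id, ← Finset.sum_sub_distrib, Finset.mul_sum]
    exact congrArg Real.exp (Finset.sum_congr rfl fun i _ => by ring)
  simp only [hexp]
  rw [integral_fintype_prod_eq_prod
    (fun i x => Real.exp (t * hM.eigenvalues i * (x ^ 2 - 1)))]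
  exact Finset.prod_congr rfl fun i _ => integral_exp_mul_sq_sub_one_gaussianReal (ht i)

theorem integrable_exp_mul_quadratic_stdGaussian (hM : M.IsHermitian) {t : ℝ}
    (ht : ∀ i, t * hM.eigenvalues i < 1 / 2) :
    Integrable (fun x : EuclideanSpace ℝ ι => Real.exp (t * (x.ofLp ⬝ᵥ M *ᵥ x.ofLp - M.trace)))
      (stdGaussian _) := by
  refine mgf_pos_iff.1 ?_
  rw [mgf_quadratic_stdGaussian hM ht]
  refine Finset.prod_pos fun i _ => mul_pos (Real.exp_pos _) (inv_pos.2 (Real.sqrt_pos.2 ?_))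
  linarith [ht i]

theorem mgf_quadratic_stdGaussian_le (hM : M.IsHermitian) {t : ℝ} (ht : |t| * ‖M‖ ≤ 1 / 4) :
    mgf (fun x : EuclideanSpace ℝ ι => x.ofLp ⬝ᵥ M *ᵥ x.ofLp - M.trace) (stdGaussian _) t ≤
      Real.exp (4 * (t * ‖M‖) ^ 2 * Fintype.card ι) := by
  have hs (i : ι) : |t * hM.eigenvalues i| ≤ |t| * ‖M‖ := by
    rw [abs_mul]
    gcongr
    exact abs_eigenvalues_le_norm hM i
  rw [mgf_quadratic_stdGaussian hM fun i => by linarith [(abs_le.1 (hs i)).2]]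
  calc ∏ i, (Real.exp (-(t * hM.eigenvalues i)) * (√(1 - 2 * (t * hM.eigenvalues i)))⁻¹)
      ≤ ∏ _i : ι, Real.exp (4 * (t * ‖M‖) ^ 2) := by
        refine Finset.prod_le_prod (fun i _ => by positivity) fun i _ => ?_
        refine (exp_neg_mul_inv_sqrt_le ((hs i).trans ht)).trans (Real.exp_le_exp.2 ?_)
        rw [← sq_abs, ← sq_abs (t * ‖M‖), abs_mul t ‖M‖, abs_norm]
        gcongr
        exact hs i
    _ = Real.exp (4 * (t * ‖M‖) ^ 2 * Fintype.card ι) := by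
        rw [Finset.prod_const, Finset.card_univ, ← Real.exp_nat_mul, mul_comm]

theorem measureReal_le_quadratic_stdGaussian_le (hM : M.IsHermitian) {D ε : ℝ} (hε : 0 < ε)
    (hεD : ε ≤ D) (hD : ‖M‖ ≤ D) :
    (stdGaussian (EuclideanSpace ℝ ι)).real
        {x | ε * Fintype.card ι ≤ x.ofLp ⬝ᵥ M *ᵥ x.ofLp - M.trace} ≤
      Real.exp (-(ε ^ 2 / (16 * D ^ 2)) * Fintype.card ι) := by
  have hD0 : 0 < D := hε.trans_le hεD
  -- `t` minimizes the exponent `4 * (t * D) ^ 2 - t * ε` of the Chernoff bound.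
  set t : ℝ := ε / (8 * D ^ 2) with ht
  have ht0 : 0 < t := by positivity
  have htM : |t| * ‖M‖ ≤ 1 / 4 := by
    calc |t| * ‖M‖ ≤ t * D := by rw [abs_of_pos ht0]; gcongr
      _ ≤ 1 / 4 := by
        rw [ht, div_mul_eq_mul_div, div_le_div_iff₀ (by positivity) (by norm_num)]
        nlinarith
  have hint := integrable_exp_mul_quadratic_stdGaussian hM (t := t) fun i => by
    nlinarith [(abs_le.1 (abs_eigenvalues_le_norm hM i)).2, abs_of_pos ht0]
  calc _ ≤ Real.exp (-t * (ε * Fintype.card ι)) * Real.exp (4 * (t * ‖M‖) ^ 2 * Fintype.card ι) :=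
        (measure_ge_le_exp_mul_mgf _ ht0.le hint).trans <|
          mul_le_mul_of_nonneg_left (mgf_quadratic_stdGaussian_le hM htM) (Real.exp_pos _).le
    _ ≤ Real.exp (-t * (ε * Fintype.card ι)) * Real.exp (4 * (t * D) ^ 2 * Fintype.card ι) := by
        gcongr
    _ = Real.exp (-(ε ^ 2 / (16 * D ^ 2)) * Fintype.card ι) := by
        rw [← Real.exp_add, ht]
        congr 1
        field_simp
        ring

theorem measureReal_le_abs_quadratic_stdGaussian_le (hM : M.IsHermitian) {D ε : ℝ} (hε : 0 < ε)
    (hεD : ε ≤ D) (hD : ‖M‖ ≤ D) :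
    (stdGaussian (EuclideanSpace ℝ ι)).real
        {x | ε * Fintype.card ι ≤ |x.ofLp ⬝ᵥ M *ᵥ x.ofLp - M.trace|} ≤
      2 * Real.exp (-(ε ^ 2 / (16 * D ^ 2)) * Fintype.card ι) := by
  have hunion : {x : EuclideanSpace ℝ ι |
      ε * Fintype.card ι ≤ |x.ofLp ⬝ᵥ M *ᵥ x.ofLp - M.trace|} =
      {x | ε * Fintype.card ι ≤ x.ofLp ⬝ᵥ M *ᵥ x.ofLp - M.trace} ∪
        {x | ε * Fintype.card ι ≤ x.ofLp ⬝ᵥ (-M) *ᵥ x.ofLp - (-M).trace} := by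
    ext x
    simp only [le_abs, Set.mem_union, Set.mem_ofPred_eq, neg_mulVec, dotProduct_neg, trace_neg,
      neg_sub, sub_neg_eq_add, neg_add_eq_sub]
  rw [hunion, two_mul]
  exact (measureReal_union_le _ _).trans <| add_le_add
    (measureReal_le_quadratic_stdGaussian_le hM hε hεD hD)
    (measureReal_le_quadratic_stdGaussian_le hM.neg hε hεD ((norm_neg M).trans_le hD))

variable {Cov A : Matrix ι ι ℝ}

theorem measureReal_le_abs_quadratic_multivariateGaussian_le (hCov : Cov.PosSemidef)
    (hA : A.IsHermitian) {D ε : ℝ} (hε : 0 < ε) (hεD : ε ≤ D) (hD : ‖A‖ * ‖Cov‖ ≤ D) :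
    (multivariateGaussian 0 Cov).real
        {x | ε * Fintype.card ι ≤ |x.ofLp ⬝ᵥ A *ᵥ x.ofLp - (A * Cov).trace|} ≤
      2 * Real.exp (-(ε ^ 2 / (16 * D ^ 2)) * Fintype.card ι) := by
  set S := CFC.sqrt Cov
  have hSS : S * S = Cov := CFC.sqrt_mul_sqrt_self Cov hCov.nonneg
  have hS : S.IsHermitian := (CFC.sqrt_nonneg Cov).isSelfAdjoint
  have hST : Sᵀ = S := by simpa [IsHermitian] using hS
  have hM : (S * A * S).IsHermitian := by
    simpa only [hS.eq] using isHermitian_conjTranspose_mul_mul S hA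
  have hnorm : ‖S * A * S‖ ≤ D := by
    have hsq : ‖Cov‖ = ‖S‖ * ‖S‖ := by
      rw [← hSS, ← l2_opNorm_conjTranspose_mul_self, hS.eq]
    calc ‖S * A * S‖ ≤ ‖S‖ * ‖A‖ * ‖S‖ := (l2_opNorm_mul _ _).trans (by
          gcongr
          exact l2_opNorm_mul _ _)
      _ = ‖A‖ * ‖Cov‖ := by rw [hsq]; ring
      _ ≤ D := hD
  have hquad (x : EuclideanSpace ℝ ι) : (S *ᵥ x.ofLp) ⬝ᵥ A *ᵥ (S *ᵥ x.ofLp) - (A * Cov).trace =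
      x.ofLp ⬝ᵥ (S * A * S) *ᵥ x.ofLp - (S * A * S).trace := by
    rw [trace_mul_cycle S A S, hSS, trace_mul_comm Cov A, dotProduct_comm (S *ᵥ x.ofLp),
      ← mulVec_mulVec, ← mulVec_mulVec, dotProduct_mulVec x.ofLp S, ← mulVec_transpose, hST,
      dotProduct_comm (S *ᵥ x.ofLp)]
  rw [multivariateGaussian, map_measureReal_apply (by fun_prop)
    (measurableSet_le measurable_const (by fun_prop))]
  convert measureReal_le_abs_quadratic_stdGaussian_le hM hε hεD hnorm using 2
  ext x
  simp only [zero_add, Set.mem_preimage, Set.mem_ofPred_eq, ofLp_toEuclideanCLM, ← hquad, S]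

end QuadraticForm

section GaussianProcess

open scoped Matrix.Norms.L2Operator

variable {Ω : Type*} [MeasurableSpace Ω] {Pr : Measure Ω}

section GaussianVector

variable {ι : Type*} [Fintype ι] [DecidableEq ι] {X : ι → Ω → ℝ} {Cov A : Matrix ι ι ℝ}

theorem map_toLp_eq_multivariateGaussian (hX : HasGaussianLaw (fun ω i => X i ω) Pr)
    (hX0 : ∀ i, ∫ ω, X i ω ∂Pr = 0) (hCov : Cov.PosSemidef)
    (hXcov : ∀ i j, cov[X i, X j; Pr] = Cov i j) :
    Pr.map (fun ω => WithLp.toLp 2 fun i => X i ω) = multivariateGaussian 0 Cov := by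
  have hlaw : HasGaussianLaw (fun ω => WithLp.toLp 2 fun i => X i ω) Pr := hX.toLp_pi 2
  have := hX.isProbabilityMeasure
  have := hlaw.isGaussian_map
  refine IsGaussian.ext ?_ ?_
  · simp only [id_eq, integral_id_multivariateGaussian]
    rw [integral_map hlaw.aemeasurable (by fun_prop)]
    ext i
    rw [eval_integral_piLp fun i => (hX.eval i).integrable]
    exact hX0 i
  · rw [← ContinuousLinearMap.toBilinForm_inj]
    refine LinearMap.BilinForm.ext_basis (EuclideanSpace.basisFun ι ℝ).toBasis fun i j => ?_
    rw [ContinuousLinearMap.toBilinForm_apply, ContinuousLinearMap.toBilinForm_apply,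
      OrthonormalBasis.coe_toBasis, covarianceBilin_apply_basisFun fun i => (hX.eval i).memLp_two,
      covarianceBilin_multivariateGaussian hCov, hXcov]
    simp

theorem measureReal_le_abs_quadratic_le (hX : HasGaussianLaw (fun ω i => X i ω) Pr)
    (hX0 : ∀ i, ∫ ω, X i ω ∂Pr = 0) (hCov : Cov.PosSemidef)
    (hXcov : ∀ i j, cov[X i, X j; Pr] = Cov i j) (hA : A.IsHermitian) {D ε : ℝ} (hε : 0 < ε)
    (hεD : ε ≤ D) (hD : ‖A‖ * ‖Cov‖ ≤ D) :
    Pr.real {ω | ε * Fintype.card ι ≤ |(fun i => X i ω) ⬝ᵥ A *ᵥ (fun i => X i ω) -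
        (A * Cov).trace|} ≤
      2 * Real.exp (-(ε ^ 2 / (16 * D ^ 2)) * Fintype.card ι) := by
  have hbound := measureReal_le_abs_quadratic_multivariateGaussian_le hCov hA hε hεD hD
  rwa [← map_toLp_eq_multivariateGaussian hX hX0 hCov hXcov, measureReal_def,
    Measure.map_apply_of_aemeasurable (hX.toLp_pi 2).aemeasurable
      (measurableSet_le measurable_const (by fun_prop))] at hbound

end GaussianVector

section StrongLaw

variable {G : Type*} {V : ℕ → Finset G}

theorem ae_eventually_notMem_of_measure_le_card (hV : Monotone V)
    (hcard : Tendsto (fun n => (V n).card) atTop atTop) {s : Finset G → Set Ω} {c : ℕ → ℝ≥0∞}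
    (hc : ∑' m, c m ≠ ⊤) (hs : ∀ n, Pr (s (V n)) ≤ c (V n).card) :
    ∀ᵐ ω ∂Pr, ∀ᶠ n in atTop, ω ∉ s (V n) := by
  have hinj (n n' : ℕ) (h : (V n).card = (V n').card) : V n = V n' := by
    rcases le_total n n' with hnn' | hnn'
    · exact Finset.eq_of_subset_of_card_le (hV hnn') h.ge
    · exact (Finset.eq_of_subset_of_card_le (hV hnn') h.le).symm
  let t (m : ℕ) : Set Ω := {ω | ∃ n, (V n).card = m ∧ ω ∈ s (V n)}
  have ht (m : ℕ) : Pr (t m) ≤ c m := by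
    rcases (t m).eq_empty_or_nonempty with hempty | ⟨-, n, rfl, -⟩
    · simp [hempty]
    · refine (measure_mono ?_).trans (hs n)
      rintro ω ⟨n', hn', hω⟩
      rwa [hinj n' n hn'] at hω
  filter_upwards [ae_eventually_notMem (ne_top_of_le_ne_top hc (ENNReal.tsum_le_tsum ht))]
    with ω hω
  exact (hcard.eventually hω).mono fun n hn hmem => hn ⟨n, rfl, hmem⟩

variable [DecidableEq G] {X : G → Ω → ℝ} {Cov A : ∀ S : Finset G, Matrix S S ℝ} {C C' : ℝ}

theorem ae_eventually_abs_quadratic_lt (hV : Monotone V)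
    (hcard : Tendsto (fun n => (V n).card) atTop atTop) (hX : IsGaussianProcess X Pr)
    (hX0 : ∀ i, ∫ ω, X i ω ∂Pr = 0) (hCov : ∀ n, (Cov (V n)).PosSemidef)
    (hXcov : ∀ n, ∀ i j : V n, cov[X i, X j; Pr] = Cov (V n) i j)
    (hA : ∀ n, (A (V n)).IsHermitian) (hC : ∀ n, ‖A (V n)‖ ≤ C) (hC' : ∀ n, ‖Cov (V n)‖ ≤ C')
    {ε : ℝ} (hε : 0 < ε) :
    ∀ᵐ ω ∂Pr, ∀ᶠ n in atTop, |(fun i : V n => X i ω) ⬝ᵥ A (V n) *ᵥ (fun i : V n => X i ω) -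
      (A (V n) * Cov (V n)).trace| < ε * (V n).card := by
  have := hX.isProbabilityMeasure
  set D : ℝ := max ε (C * C')
  have hD : 0 < D := lt_max_of_lt_left hε
  have hrate : -(ε ^ 2 / (16 * D ^ 2)) < 0 :=
    neg_neg_of_pos (div_pos (pow_pos hε 2) (mul_pos (by norm_num) (pow_pos hD 2)))
  have hsum : Summable fun m : ℕ => 2 * Real.exp (-(ε ^ 2 / (16 * D ^ 2)) * m) := by
    simp only [mul_comm _ (Nat.cast _ : ℝ)]
    exact (Real.summable_exp_nat_mul_iff.2 hrate).mul_left 2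
  have hbound (n : ℕ) : Pr {ω | ε * (V n).card ≤ |(fun i : V n => X i ω) ⬝ᵥ
      A (V n) *ᵥ (fun i : V n => X i ω) - (A (V n) * Cov (V n)).trace|} ≤
      ENNReal.ofReal (2 * Real.exp (-(ε ^ 2 / (16 * D ^ 2)) * (V n).card)) := by
    rw [← ofReal_measureReal]
    refine ENNReal.ofReal_le_ofReal ?_
    simpa only [Fintype.card_coe, Finset.restrict] using measureReal_le_abs_quadratic_le
      (hX.hasGaussianLaw (V n)) (fun i => hX0 i) (hCov n) (hXcov n) (hA n) hε (le_max_left ε _)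
      ((mul_le_mul (hC n) (hC' n) (norm_nonneg _) ((norm_nonneg _).trans (hC n))).trans
        (le_max_right ε _))
  simpa only [Set.mem_ofPred_eq, not_le] using
    ae_eventually_notMem_of_measure_le_card hV hcard hsum.tsum_ofReal_ne_top
      (s := fun S => {ω | ε * S.card ≤ |(fun i : S => X i ω) ⬝ᵥ A S *ᵥ (fun i : S => X i ω) -
        (A S * Cov S).trace|}) hbound

theorem ae_tendsto_quadratic_sub_trace (hV : Monotone V)
    (hcard : Tendsto (fun n => (V n).card) atTop atTop) (hX : IsGaussianProcess X Pr)
    (hX0 : ∀ i, ∫ ω, X i ω ∂Pr = 0) (hCov : ∀ n, (Cov (V n)).PosSemidef)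
    (hXcov : ∀ n, ∀ i j : V n, cov[X i, X j; Pr] = Cov (V n) i j)
    (hA : ∀ n, (A (V n)).IsHermitian) (hC : ∀ n, ‖A (V n)‖ ≤ C)
    (hC' : ∀ n, ‖Cov (V n)‖ ≤ C') :
    ∀ᵐ ω ∂Pr, Tendsto (fun n => ((fun i : V n => X i ω) ⬝ᵥ A (V n) *ᵥ (fun i : V n => X i ω) -
      (A (V n) * Cov (V n)).trace) / (V n).card) atTop (𝓝 0) := by
  have hall := ae_all_iff.2 fun k : ℕ => ae_eventually_abs_quadratic_lt hV hcard hX hX0 hCov hXcov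
    hA hC hC' (Nat.one_div_pos_of_nat (α := ℝ) (n := k))
  filter_upwards [hall] with ω hω
  rw [Metric.tendsto_nhds]
  intro ε hε
  obtain ⟨k, hk⟩ := exists_nat_one_div_lt hε
  filter_upwards [hω k, hcard.eventually_gt_atTop 0] with n hn hpos
  rw [Real.dist_eq, sub_zero, abs_div, Nat.abs_cast, div_lt_iff₀ (Nat.cast_pos.2 hpos)]
  exact hn.trans (by gcongr)

end StrongLaw

end GaussianProcess

/-! ### Consistency of minimizers of an empirical contrast -/

section Minimizers

variable {ι T : Type*} [TopologicalSpace T] {l : Filter ι}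

theorem equicontinuous_of_eventually_abs_sub_le_mul {F : ι → T → ℝ} {C : ℝ}
    (hF : ∀ x, ∀ ε > 0, ∀ᶠ y in 𝓝 x, ∀ i, |F i y - F i x| ≤ ε * C) : Equicontinuous F := by
  intro x
  rw [Metric.equicontinuousAt_iff_right]
  intro ε hε
  filter_upwards [hF x (ε / (|C| + 1)) (by positivity)] with y hy i
  rw [Real.dist_eq, abs_sub_comm]
  calc |F i y - F i x| ≤ ε / (|C| + 1) * C := hy i
    _ ≤ ε / (|C| + 1) * |C| := by gcongr; exact le_abs_self C
    _ < ε / (|C| + 1) * (|C| + 1) := by gcongr; exact lt_add_one _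
    _ = ε := by field_simp

variable [CompactSpace T]

theorem tendstoUniformly_of_equicontinuous_of_dense {α : Type*} [UniformSpace α] {F : ι → T → α}
    {f : T → α} {s : Set T} (hF : Equicontinuous F) (hf : Continuous f) (hs : Dense s)
    (h : ∀ x ∈ s, Tendsto (F · x) l (𝓝 (f x))) : TendstoUniformly F f l := by
  have hall : ∀ x, Tendsto (F · x) l (𝓝 (f x)) := fun x =>
    (hF.isClosed_setOfPred_tendsto hf).closure_subset_iff.2 h (hs x)
  exact UniformFun.tendsto_iff_tendstoUniformly.1 <|
    (hF.tendsto_uniformFun_iff_pi l f).2 (tendsto_pi_nhds.2 hall)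

theorem tendsto_of_tendsto_unique_minimum {ℓ : T → ℝ} (hℓ : Continuous ℓ) {x₀ : T}
    (hmin : ∀ x, x ≠ x₀ → ℓ x₀ < ℓ x) {xhat : ι → T}
    (hxhat : Tendsto (fun i => ℓ (xhat i)) l (𝓝 (ℓ x₀))) : Tendsto xhat l (𝓝 x₀) := by
  refine tendsto_nhds_of_unique_mapClusterPt fun x hx => ?_
  have hcluster : MapClusterPt (ℓ x) l (ℓ ∘ xhat) := hx.continuousAt_comp hℓ.continuousAt
  have hval : ℓ x = ℓ x₀ := eq_of_nhds_neBot (hcluster.clusterPt.mono hxhat)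
  by_contra hne
  exact (hmin x hne).ne' hval

theorem tendsto_of_tendstoUniformly_of_le {F : ι → T → ℝ} {ℓ : T → ℝ} (hℓ : Continuous ℓ) {x₀ : T}
    (hmin : ∀ x, x ≠ x₀ → ℓ x₀ < ℓ x) (hF : TendstoUniformly F ℓ l) {xhat : ι → T}
    (hxhat : ∀ i, F i (xhat i) ≤ F i x₀) : Tendsto xhat l (𝓝 x₀) := by
  refine tendsto_of_tendsto_unique_minimum hℓ hmin (Metric.tendsto_nhds.2 fun ε hε => ?_)
  filter_upwards [Metric.tendstoUniformly_iff.1 hF (ε / 2) (half_pos hε)] with i hi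
  have hle : ℓ x₀ ≤ ℓ (xhat i) := by
    rcases eq_or_ne (xhat i) x₀ with h | h
    · rw [h]
    · exact (hmin _ h).le
  rw [Real.dist_eq, abs_of_nonneg (sub_nonneg.2 hle)]
  linarith [(abs_lt.1 (hi (xhat i))).2, (abs_lt.1 (hi x₀)).1, hxhat i]

end Minimizers

theorem maximizersConverge_of_ae_tendsto_minimizers {Ω : Type*} [MeasurableSpace Ω] {Pr : Measure Ω}
    {Θ : Set ℝ} (hΘ : IsCompact Θ) {θ₀ : Θ} {L : ℕ → ℝ → Ω → ℝ} {F : ℕ → Θ → Ω → ℝ}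
    (hLF : ∀ n ω (θ θ' : Θ), L n θ ω ≤ L n θ' ω ↔ F n θ' ω ≤ F n θ ω)
    (hF : ∀ n ω, Continuous fun θ => F n θ ω)
    (hmin : ∀ᵐ ω ∂Pr, ∀ θhat : ℕ → Θ, (∀ n, F n (θhat n) ω ≤ F n θ₀ ω) →
      Tendsto θhat atTop (𝓝 θ₀)) :
    MaximizersConverge Pr Θ θ₀ L := by
  have := isCompact_iff_compactSpace.1 hΘ
  have : Nonempty Θ := ⟨θ₀⟩
  refine ⟨fun n ω => ?_, fun θhat hθhat => ?_⟩
  · obtain ⟨θ, -, hθ⟩ := isCompact_univ.exists_isMinOn Set.univ_nonempty (hF n ω).continuousOn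
    exact ⟨θ, θ.2, fun θ' hθ' => (hLF n ω ⟨θ', hθ'⟩ θ).2 (hθ (Set.mem_univ _))⟩
  · filter_upwards [hmin, ae_all_iff.2 hθhat] with ω hω hmax
    exact (continuous_subtype_val.tendsto θ₀).comp <| hω (fun n => ⟨θhat n ω, (hmax n).1⟩)
      fun n => (hLF n ω θ₀ ⟨θhat n ω, (hmax n).1⟩).1 ((hmax n).2 θ₀.2)

section EmpiricalContrast

open scoped Matrix.Norms.L2Operator

variable {G T : Type*} [TopologicalSpace T] {V : ℕ → Finset G}
  {D : Finset G → T → ℝ} {Cov : ∀ S : Finset G, Matrix S S ℝ} {A : ∀ S : Finset G, T → Matrix S S ℝ}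
  {d e : T → ℝ}

/-- The terms of `-2` times a Gaussian quasi-log-likelihood that depend on the parameter, as a
function of the parameter `θ` and of the observations `x` on `S`. -/
def empiricalContrast (D : Finset G → T → ℝ) (A : ∀ S : Finset G, T → Matrix S S ℝ) (S : Finset G)
    (x : S → ℝ) (θ : T) : ℝ :=
  D S θ + x ⬝ᵥ A S θ *ᵥ x

/-- Regularity of the deterministic term `D` of an empirical contrast along `V`: per vertex it is
equicontinuous in the parameter and converges to `d`. -/
structure LogTermConverges (V : ℕ → Finset G) (D : Finset G → T → ℝ) (d : T → ℝ) : Prop where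
  equicontinuous : ∀ θ, ∀ ε > 0, ∀ᶠ θ' in 𝓝 θ, ∀ n,
    |D (V n) θ' - D (V n) θ| ≤ ε * (V n).card
  tendsto : ∀ θ, Tendsto (fun n => D (V n) θ / (V n).card) atTop (𝓝 (d θ))

theorem abs_div_natCast_sub_div_natCast_le {a b c : ℝ} (hc : 0 ≤ c) {m : ℕ}
    (h : |a - b| ≤ c * m) : |a / m - b / m| ≤ c := by
  rw [← sub_div, abs_div, Nat.abs_cast]
  exact div_le_of_le_mul₀ m.cast_nonneg hc h

theorem LogTermConverges.continuous (hD : LogTermConverges V D d) : Continuous d := by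
  refine Filter.Tendsto.continuous_of_equicontinuous (tendsto_pi_nhds.2 hD.tendsto)
    (equicontinuous_of_eventually_abs_sub_le_mul (C := 1) fun θ ε hε => ?_)
  filter_upwards [hD.equicontinuous θ ε hε] with θ' hθ' n
  rw [mul_one]
  exact abs_div_natCast_sub_div_natCast_le hε.le (hθ' n)

variable [DecidableEq G]

/-- Regularity of the quadratic term of an empirical contrast along `V`: the matrices `A` are
symmetric, bounded and equicontinuous in operator norm, and for observations with covariance `Cov`
the mean of the quadratic form per vertex converges to `e`. -/
structure QuadraticTermConverges (V : ℕ → Finset G) (Cov : ∀ S : Finset G, Matrix S S ℝ)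
    (A : ∀ S : Finset G, T → Matrix S S ℝ) (e : T → ℝ) : Prop where
  isHermitian : ∀ n θ, (A (V n) θ).IsHermitian
  exists_norm_le : ∀ θ, ∃ C, ∀ n, ‖A (V n) θ‖ ≤ C
  equicontinuous : ∀ θ, ∀ ε > 0, ∀ᶠ θ' in 𝓝 θ, ∀ n, ‖A (V n) θ' - A (V n) θ‖ ≤ ε
  tendsto : ∀ θ, Tendsto (fun n => (A (V n) θ * Cov (V n)).trace / (V n).card) atTop (𝓝 (e θ))

theorem QuadraticTermConverges.continuous (hA : QuadraticTermConverges V Cov A e) {C : ℝ}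
    (hC : ∀ n, ‖Cov (V n)‖ ≤ C) : Continuous e := by
  refine Filter.Tendsto.continuous_of_equicontinuous (tendsto_pi_nhds.2 hA.tendsto)
    (equicontinuous_of_eventually_abs_sub_le_mul (C := C) fun θ ε hε => ?_)
  have hC0 : 0 ≤ C := (norm_nonneg _).trans (hC 0)
  filter_upwards [hA.equicontinuous θ ε hε] with θ' hθ' n
  refine abs_div_natCast_sub_div_natCast_le (by positivity) ?_
  rw [← Matrix.trace_sub, ← sub_mul, mul_comm, ← Fintype.card_coe (V n)]
  refine (abs_trace_le_card_mul_norm _).trans ?_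
  gcongr
  exact (norm_mul_le _ _).trans (mul_le_mul (hθ' n) (hC n) (norm_nonneg _) hε.le)

theorem eventually_abs_empiricalContrast_sub_le (hD : LogTermConverges V D d)
    (hA : QuadraticTermConverges V Cov A e) (θ : T) {ε : ℝ} (hε : 0 < ε) :
    ∀ᶠ θ' in 𝓝 θ, ∀ n, ∀ x : V n → ℝ, |empiricalContrast D A (V n) x θ' -
      empiricalContrast D A (V n) x θ| ≤ ε * ((V n).card + x ⬝ᵥ x) := by
  filter_upwards [hD.equicontinuous θ ε hε, hA.equicontinuous θ ε hε] with θ' hDθ' hAθ' n x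
  have hx : 0 ≤ x ⬝ᵥ x := dotProduct_self_star_nonneg x
  have hquad : |x ⬝ᵥ A (V n) θ' *ᵥ x - x ⬝ᵥ A (V n) θ *ᵥ x| ≤ ε * (x ⬝ᵥ x) := by
    rw [← dotProduct_sub, ← Matrix.sub_mulVec]
    exact (abs_dotProduct_mulVec_self_le _ x).trans (mul_le_mul_of_nonneg_right (hAθ' n) hx)
  rw [empiricalContrast, empiricalContrast, add_sub_add_comm, mul_add]
  exact (abs_add_le _ _).trans (add_le_add (hDθ' n) hquad)

theorem continuous_empiricalContrast (hD : LogTermConverges V D d)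
    (hA : QuadraticTermConverges V Cov A e) (n : ℕ) (x : V n → ℝ) :
    Continuous (empiricalContrast D A (V n) x) := by
  refine (equicontinuous_of_eventually_abs_sub_le_mul (C := (V n).card + x ⬝ᵥ x)
    (F := fun _ : Unit => empiricalContrast D A (V n) x) fun θ ε hε => ?_).continuous ()
  filter_upwards [eventually_abs_empiricalContrast_sub_le hD hA θ hε] with θ' hθ' _
  exact hθ' n x

theorem equicontinuous_empiricalContrast_div_card (hD : LogTermConverges V D d)
    (hA : QuadraticTermConverges V Cov A e) {x : ∀ n, V n → ℝ} {R : ℝ}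
    (hR : ∀ n, x n ⬝ᵥ x n ≤ R * (V n).card) :
    Equicontinuous fun n θ => empiricalContrast D A (V n) (x n) θ / (V n).card := by
  refine equicontinuous_of_eventually_abs_sub_le_mul (C := 1 + |R|) fun θ ε hε => ?_
  filter_upwards [eventually_abs_empiricalContrast_sub_le hD hA θ hε] with θ' hθ' n
  refine abs_div_natCast_sub_div_natCast_le (by positivity) ((hθ' n (x n)).trans ?_)
  rw [mul_assoc, one_add_mul]
  gcongr
  exact (hR n).trans (by gcongr; exact le_abs_self R)

end EmpiricalContrast

section Consistency

open scoped Matrix.Norms.L2Operator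

variable {G T Ω : Type*} [DecidableEq G] [MeasurableSpace Ω] {Pr : Measure Ω} {V : ℕ → Finset G}
  {X : G → Ω → ℝ} {Cov : ∀ S : Finset G, Matrix S S ℝ} {C : ℝ}

theorem ae_exists_dotProduct_self_le_mul_card (hV : Monotone V)
    (hcard : Tendsto (fun n => (V n).card) atTop atTop) (hX : IsGaussianProcess X Pr)
    (hX0 : ∀ i, ∫ ω, X i ω ∂Pr = 0) (hCov : ∀ n, (Cov (V n)).PosSemidef)
    (hXcov : ∀ n, ∀ i j : V n, cov[X i, X j; Pr] = Cov (V n) i j) (hC : ∀ n, ‖Cov (V n)‖ ≤ C) :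
    ∀ᵐ ω ∂Pr, ∃ R, ∀ n, (fun i : V n => X i ω) ⬝ᵥ (fun i : V n => X i ω) ≤ R * (V n).card := by
  have hone : ∀ n, ‖(1 : Matrix (V n) (V n) ℝ)‖ ≤ 1 := fun n =>
    l2_opNorm_le_of_forall_norm_mulVec_le zero_le_one fun x => by simp
  filter_upwards [ae_tendsto_quadratic_sub_trace (A := fun _ => 1) hV hcard hX hX0 hCov hXcov
    (fun _ => Matrix.isHermitian_one) hone hC] with ω hω
  obtain ⟨R, hR⟩ := hω.bddAbove_range
  refine ⟨R + C, fun n => ?_⟩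
  rcases (V n).eq_empty_or_nonempty with hempty | hne
  · have : IsEmpty (V n) := Finset.isEmpty_coe_sort.2 hempty
    simp [dotProduct, hempty]
  · have htrace := (le_abs_self _).trans (abs_trace_le_card_mul_norm (Cov (V n)))
    have hn := hR ⟨n, rfl⟩
    simp only [Matrix.one_mulVec, one_mul] at hn
    rw [div_le_iff₀ (by exact_mod_cast hne.card_pos)] at hn
    rw [Fintype.card_coe] at htrace
    nlinarith [mul_le_mul_of_nonneg_left (hC n) (Nat.cast_nonneg (α := ℝ) (V n).card)]

variable [TopologicalSpace T] [CompactSpace T] [TopologicalSpace.SeparableSpace T]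
  {D : Finset G → T → ℝ} {A : ∀ S : Finset G, T → Matrix S S ℝ} {d e : T → ℝ} {θ₀ : T}

theorem ae_tendsto_of_empiricalContrast_le (hV : Monotone V)
    (hcard : Tendsto (fun n => (V n).card) atTop atTop) (hX : IsGaussianProcess X Pr)
    (hX0 : ∀ i, ∫ ω, X i ω ∂Pr = 0) (hCov : ∀ n, (Cov (V n)).PosSemidef)
    (hXcov : ∀ n, ∀ i j : V n, cov[X i, X j; Pr] = Cov (V n) i j) (hC : ∀ n, ‖Cov (V n)‖ ≤ C)
    (hD : LogTermConverges V D d) (hA : QuadraticTermConverges V Cov A e)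
    (hmin : ∀ θ, θ ≠ θ₀ → d θ₀ + e θ₀ < d θ + e θ) :
    ∀ᵐ ω ∂Pr, ∀ θhat : ℕ → T,
      (∀ n, empiricalContrast D A (V n) (fun i => X i ω) (θhat n) ≤
        empiricalContrast D A (V n) (fun i => X i ω) θ₀) →
      Tendsto θhat atTop (𝓝 θ₀) := by
  obtain ⟨s, hs, hdense⟩ := TopologicalSpace.exists_countable_dense T
  have hlaw : ∀ᵐ ω ∂Pr, ∀ θ ∈ s, Tendsto (fun n => ((fun i : V n => X i ω) ⬝ᵥ
      A (V n) θ *ᵥ (fun i : V n => X i ω) - (A (V n) θ * Cov (V n)).trace) / (V n).card)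
      atTop (𝓝 0) := (ae_ball_iff hs).2 fun θ _ => by
    obtain ⟨C', hC'⟩ := hA.exists_norm_le θ
    exact ae_tendsto_quadratic_sub_trace (A := fun S => A S θ) hV hcard hX hX0 hCov hXcov
      (fun n => hA.isHermitian n θ) hC' hC
  filter_upwards [hlaw, ae_exists_dotProduct_self_le_mul_card hV hcard hX hX0 hCov hXcov hC]
    with ω hω ⟨R, hR⟩ θhat hθhat
  have hcont : Continuous fun θ => d θ + e θ := hD.continuous.add (hA.continuous hC)
  refine tendsto_of_tendstoUniformly_of_le hcont hmin
    (tendstoUniformly_of_equicontinuous_of_dense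
      (equicontinuous_empiricalContrast_div_card hD hA hR) hcont hdense fun θ hθ => ?_)
    fun n => div_le_div_of_nonneg_right (hθhat n) (Nat.cast_nonneg _)
  have hsum := (hD.tendsto θ).add ((hω θ hθ).add (hA.tendsto θ))
  rw [zero_add] at hsum
  exact hsum.congr fun n => by rw [empiricalContrast]; ring

end Consistency

/-! ### The boundary correction -/

theorem spectralMeasure_neg {H : Type*} [NormedAddCommGroup H] [InnerProductSpace ℂ H]
    [CompleteSpace H] (A : H →L[ℂ] H) (hA : IsSelfAdjoint A) (v : H) :
    spectralMeasure A hA (-v) = spectralMeasure A hA v := by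
  have : spectralFunctional A hA (-v) = spectralFunctional A hA v := by
    ext g
    change (inner ℂ (-v) (cfcHom (R := ℝ) hA g.toContinuousMap (-v))).re =
      (inner ℂ v (cfcHom (R := ℝ) hA g.toContinuousMap v)).re
    rw [map_neg, inner_neg_neg]
  rw [spectralMeasure, spectralMeasure, this]

namespace WeightedGraph

open scoped Matrix.Norms.L2Operator

variable {G : Type*} (Γ : WeightedGraph G)

theorem pairMeasure_comm (i j : G) : Γ.pairMeasure i j = Γ.pairMeasure j i := by
  have hneg : (delta j - delta i : lp (fun _ : G => ℂ) 2) = -(delta i - delta j) :=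
    (neg_sub _ _).symm
  simp only [pairMeasure, add_comm (delta j) (delta i), hneg, spectralMeasure_neg]

theorem B_comm (P : ℕ) (S : Finset G) (i j : S) : Γ.B P S i j = Γ.B P S j i := by
  simp only [B, Matrix.of_apply]
  rw [SimpleGraph.edist_comm, Γ.pairMeasure_comm i j]

theorem B_apply_of_lt_edist {P : ℕ} {S : Finset G} {i j : S} (hij : P < Γ.graph.edist i j) :
    Γ.B P S i j = 1 := by
  simp [B, hij.not_ge]

theorem isHermitian_Qmat (P : ℕ) (S : Finset G) (h : ℝ → ℝ) : (Γ.Qmat P S h).IsHermitian := by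
  ext i j
  simp only [Qmat, Matrix.conjTranspose_apply, Matrix.hadamard_apply, star_trivial, Kmat_apply]
  rw [Γ.B_comm, Γ.K_comm]

theorem Qmat_sub (P : ℕ) (S : Finset G) {g h : ℝ → ℝ} (hg : ContinuousOn g Γ.Sp)
    (hh : ContinuousOn h Γ.Sp) :
    Γ.Qmat P S (fun x => g x - h x) = Γ.Qmat P S g - Γ.Qmat P S h := by
  rw [Qmat, Γ.Kmat_sub S hg hh]
  ext i j
  simp [Qmat, mul_sub]

theorem setOf_walk_length_le_succ_subset (P : ℕ) (i : G) :
    {j | ∃ p : Γ.graph.Walk i j, p.length ≤ P + 1} ⊆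
      insert i (⋃ k ∈ {k | Γ.W i k ≠ 0}, {j | ∃ p : Γ.graph.Walk k j, p.length ≤ P}) := by
  rintro j ⟨p, hp⟩
  cases p with
  | nil => exact Set.mem_insert _ _
  | cons hadj p =>
    exact Set.mem_insert_of_mem _ (Set.mem_biUnion hadj.2 ⟨p, by simpa using hp⟩)

theorem exists_encard_walk_length_le (P : ℕ) :
    ∃ N : ℕ, ∀ i, {j | ∃ p : Γ.graph.Walk i j, p.length ≤ P}.encard ≤ N := by
  induction P with
  | zero =>
    refine ⟨1, fun i => ?_⟩
    have hsub : {j | ∃ p : Γ.graph.Walk i j, p.length ≤ 0} ⊆ {i} := by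
      rintro j ⟨p, hp⟩
      exact (SimpleGraph.Walk.eq_of_length_eq_zero (Nat.le_zero.1 hp)).symm
    exact (Set.encard_le_encard hsub).trans (Set.encard_singleton i).le
  | succ P ih =>
    obtain ⟨N, hN⟩ := ih
    obtain ⟨D, hD⟩ := Γ.bddAbove_degree
    refine ⟨D * N + 1, fun i => ?_⟩
    have hdeg : (Γ.finite_neighbors i).toFinset.card ≤ D := by
      rw [← Set.ncard_eq_toFinset_card _ (Γ.finite_neighbors i)]
      exact hD ⟨i, rfl⟩
    calc {j | ∃ p : Γ.graph.Walk i j, p.length ≤ P + 1}.encard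
        ≤ (⋃ k ∈ {k | Γ.W i k ≠ 0}, {j | ∃ p : Γ.graph.Walk k j, p.length ≤ P}).encard + 1 :=
          (Set.encard_le_encard (Γ.setOf_walk_length_le_succ_subset P i)).trans
            (Set.encard_insert_le _ _)
      _ ≤ ∑ k ∈ (Γ.finite_neighbors i).toFinset,
            {j | ∃ p : Γ.graph.Walk k j, p.length ≤ P}.encard + 1 := by
          gcongr
          simpa using Finset.set_encard_biUnion_le (Γ.finite_neighbors i).toFinset
            fun k => {j | ∃ p : Γ.graph.Walk k j, p.length ≤ P}
      _ ≤ D * N + 1 := by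
          gcongr
          refine (Finset.sum_le_card_nsmul _ _ _ fun k _ => hN k).trans ?_
          rw [nsmul_eq_mul]
          gcongr
      _ = (D * N + 1 : ℕ) := by push_cast; rfl

theorem exists_ncard_edist_le (P : ℕ) : ∃ N : ℕ, ∀ (S : Finset G) (i : S),
    {j : S | Γ.graph.edist i j ≤ P}.ncard ≤ N := by
  obtain ⟨N, hN⟩ := Γ.exists_encard_walk_length_le P
  refine ⟨N, fun S i => ?_⟩
  have hsub : Subtype.val '' {j : S | Γ.graph.edist i j ≤ P} ⊆
      {j | ∃ p : Γ.graph.Walk i j, p.length ≤ P} := by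
    rintro _ ⟨j, hj, rfl⟩
    obtain ⟨p, hp⟩ := SimpleGraph.exists_walk_of_edist_ne_top
      (ne_top_of_le_ne_top (ENat.natCast_ne_top P) hj)
    exact ⟨p, by exact_mod_cast hp.le.trans hj⟩
  rw [← Nat.cast_le (α := ℕ∞), (Set.toFinite _).cast_ncard_eq,
    ← Subtype.val_injective.encard_image]
  exact (Set.encard_le_encard hsub).trans (hN i)

theorem abs_K_le {h : ℝ → ℝ} {C : ℝ} (hC : 0 ≤ C) (hhC : ∀ x ∈ Γ.Sp, |h x| ≤ C) (i j : G) :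
    |Γ.K h i j| ≤ C := by
  calc |Γ.K h i j| ≤ ‖operatorFunction Γ.op h (delta j) i‖ := by
        rw [Γ.operatorFunction_delta_apply, Complex.norm_real, Real.norm_eq_abs]
    _ ≤ ‖operatorFunction Γ.op h (delta j)‖ := lp.norm_apply_le_norm two_ne_zero _ _
    _ ≤ ‖operatorFunction Γ.op h‖ * ‖delta j‖ := ContinuousLinearMap.le_opNorm _ _
    _ ≤ C := by rw [norm_delta, mul_one]; exact norm_operatorFunction_le hC hhC

theorem norm_Qmat_sub_Kmat_le [DecidableEq G] {P N : ℕ} {S : Finset G}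
    (hN : ∀ i : S, {j : S | Γ.graph.edist i j ≤ P}.ncard ≤ N) {u : ℝ}
    (hB : ∀ i j : S, |Γ.B P S i j - 1| ≤ u) {h : ℝ → ℝ} {C : ℝ} (hC : 0 ≤ C)
    (hhC : ∀ x ∈ Γ.Sp, |h x| ≤ C) :
    ‖Γ.Qmat P S h - Γ.Kmat S h‖ ≤ N * (|u| * C) := by
  classical
  have hentry : ∀ i j : S, |(Γ.Qmat P S h - Γ.Kmat S h) i j| ≤
      if Γ.graph.edist i j ≤ P then |u| * C else 0 := fun i j => by
    have hsub : (Γ.Qmat P S h - Γ.Kmat S h) i j = (Γ.B P S i j - 1) * Γ.K h i j := by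
      simp [Qmat, Kmat_apply, sub_mul]
    rw [hsub, abs_mul]
    split_ifs with hij
    · exact mul_le_mul ((hB i j).trans (le_abs_self u)) (Γ.abs_K_le hC hhC i j) (abs_nonneg _)
        (abs_nonneg _)
    · simp [Γ.B_apply_of_lt_edist (not_le.1 hij)]
  have hrow : ∀ i, ∑ j, |(Γ.Qmat P S h - Γ.Kmat S h) i j| ≤ N * (|u| * C) := fun i => by
    have hcard : (Finset.univ.filter fun j : S => Γ.graph.edist i j ≤ P).card ≤ N := by
      rw [← Set.ncard_coe_finset]
      simpa using hN i
    calc ∑ j, |(Γ.Qmat P S h - Γ.Kmat S h) i j|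
        ≤ ∑ j : S, if Γ.graph.edist i j ≤ P then |u| * C else 0 :=
          Finset.sum_le_sum fun j _ => hentry i j
      _ = (Finset.univ.filter fun j : S => Γ.graph.edist i j ≤ P).card * (|u| * C) := by
          rw [← Finset.sum_filter, Finset.sum_const, nsmul_eq_mul]
      _ ≤ N * (|u| * C) := by gcongr
  refine l2_opNorm_le_of_sum_abs_le (by positivity) hrow fun j => ?_
  have hsymm := (Γ.isHermitian_Qmat P S h).sub (Γ.isHermitian_Kmat S h)
  simpa only [← hsymm.apply j, star_trivial] using hrow j

theorem norm_Qmat_le [DecidableEq G] {P N : ℕ} {S : Finset G}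
    (hN : ∀ i : S, {j : S | Γ.graph.edist i j ≤ P}.ncard ≤ N) {u : ℝ}
    (hB : ∀ i j : S, |Γ.B P S i j - 1| ≤ u) {h : ℝ → ℝ} {C : ℝ} (hC : 0 ≤ C)
    (hhC : ∀ x ∈ Γ.Sp, |h x| ≤ C) : ‖Γ.Qmat P S h‖ ≤ (N * |u| + 1) * C := by
  calc ‖Γ.Qmat P S h‖ ≤ ‖Γ.Qmat P S h - Γ.Kmat S h‖ + ‖Γ.Kmat S h‖ := norm_le_norm_sub_add _ _
    _ ≤ N * (|u| * C) + C :=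
        add_le_add (Γ.norm_Qmat_sub_Kmat_le hN hB hC hhC) (Γ.norm_Kmat_le S hC hhC)
    _ = (N * |u| + 1) * C := by ring

end WeightedGraph

/-! ### Families of spectral densities -/

section Families

variable {T α : Type*} [TopologicalSpace T] [TopologicalSpace α] {F : T → α → ℝ} {k : Set α}

theorem eventually_forall_abs_sub_le_of_continuousOn (hk : IsCompact k)
    (hF : ContinuousOn F.uncurry (Set.univ ×ˢ k)) (θ : T) {ε : ℝ} (hε : 0 < ε) :
    ∀ᶠ θ' in 𝓝 θ, ∀ x ∈ k, |F θ' x - F θ x| ≤ ε := by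
  obtain ⟨v, hv, hvF⟩ :=
    hk.mem_uniformity_of_prod hF (Set.mem_univ θ) (Metric.dist_mem_uniformity hε)
  rw [nhdsWithin_univ] at hv
  filter_upwards [hv] with θ' hθ' x hx using (hvF θ' hθ' x hx).le

theorem exists_eventually_forall_le_of_continuousOn (hk : IsCompact k)
    (hF : ContinuousOn F.uncurry (Set.univ ×ˢ k)) (θ : T) (hpos : ∀ x ∈ k, 0 < F θ x) :
    ∃ c, 0 < c ∧ ∀ᶠ θ' in 𝓝 θ, ∀ x ∈ k, c ≤ F θ' x := by
  obtain ⟨c, hc, hcF⟩ := hk.exists_forall_le' (hF.uncurry_left θ (Set.mem_univ θ)) hpos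
  refine ⟨c / 2, half_pos hc, ?_⟩
  filter_upwards [eventually_forall_abs_sub_le_of_continuousOn hk hF θ (half_pos hc)]
    with θ' hθ' x hx
  linarith [(abs_le.1 (hθ' x hx)).1, hcF x hx]

end Families

namespace WeightedGraph

open scoped Matrix.Norms.L2Operator MatrixOrder

variable {G T : Type*} [TopologicalSpace T] {Γ : WeightedGraph G} {V : ℕ → Finset G}
  {μ : FiniteMeasure ℝ} {F : T → ℝ → ℝ} {g : ℝ → ℝ}

theorem logTermConverges_card_mul_integral
    (hcard : Tendsto (fun n => (V n).card) atTop atTop)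
    (hμ : Tendsto (fun n => Γ.avgMeasure (V n)) atTop (𝓝 μ))
    (hF : ContinuousOn F.uncurry (Set.univ ×ˢ Γ.Sp)) :
    LogTermConverges V (fun S θ => S.card * ∫ x, F θ x ∂(μ : Measure ℝ))
      fun θ => ∫ x, F θ x ∂(μ : Measure ℝ) where
  equicontinuous θ ε hε := by
    have hint (θ : T) : Integrable (F θ) (μ : Measure ℝ) :=
      integrable_of_continuousOn_Sp hμ (hF.uncurry_left θ (Set.mem_univ θ))
    filter_upwards [eventually_forall_abs_sub_le_of_continuousOn Γ.isCompact_Sp hF θ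
      (ε := ε / (μ.mass + 1)) (by positivity)] with θ' hθ' n
    rw [← mul_sub, abs_mul, Nat.abs_cast, mul_comm, ← integral_sub (hint θ') (hint θ)]
    gcongr
    calc |∫ x, F θ' x - F θ x ∂(μ : Measure ℝ)|
        ≤ ε / (μ.mass + 1) * (μ : Measure ℝ).real Set.univ :=
          (Real.norm_eq_abs _).ge.trans <| norm_integral_le_of_norm_le_const <|
            (ae_mem_Sp hμ).mono hθ'
      _ ≤ ε / (μ.mass + 1) * (μ.mass + 1) := by
          gcongr
          exact (lt_add_one _).le
      _ = ε := by field_simp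
  tendsto θ := by
    refine tendsto_const_nhds.congr' ?_
    filter_upwards [hcard.eventually_gt_atTop 0] with n hn
    rw [mul_div_cancel_left₀ _ (by exact_mod_cast hn.ne')]

theorem tendsto_trace_Qmat_sub_Kmat_mul {P : ℕ} {u : ℕ → ℝ} (hu : Tendsto u atTop (𝓝 0))
    (hB : ∀ n, ∀ i j : V n, |Γ.B P (V n) i j - 1| ≤ u n) {f : ℝ → ℝ} (hf : ContinuousOn f Γ.Sp)
    (hg : ContinuousOn g Γ.Sp) :
    Tendsto (fun n => ((Γ.Qmat P (V n) f - Γ.Kmat (V n) f) * Γ.Kmat (V n) g).trace / (V n).card)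
      atTop (𝓝 0) := by
  classical
  obtain ⟨N, hN⟩ := Γ.exists_ncard_edist_le P
  obtain ⟨C, hC, hfC⟩ := Γ.exists_abs_le hf
  obtain ⟨C', hC', hgC'⟩ := Γ.exists_abs_le hg
  have hlim : Tendsto (fun n => N * (|u n| * C) * C') atTop (𝓝 0) := by
    simpa using ((hu.abs.mul_const C).const_mul (N : ℝ)).mul_const C'
  refine squeeze_zero_norm (fun n => ?_) hlim
  rw [Real.norm_eq_abs, abs_div, Nat.abs_cast]
  refine div_le_of_le_mul₀ (Nat.cast_nonneg _) (by positivity) ?_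
  rw [mul_comm, ← Fintype.card_coe (V n)]
  refine (abs_trace_le_card_mul_norm _).trans ?_
  gcongr
  exact (norm_mul_le _ _).trans (mul_le_mul (Γ.norm_Qmat_sub_Kmat_le (hN _) (hB n) hC hfC)
    (Γ.norm_Kmat_le _ hC' hgC') (norm_nonneg _) (by positivity))

variable [DecidableEq G]

theorem eventually_forall_norm_Kmat_sub_le (hF : ContinuousOn F.uncurry (Set.univ ×ˢ Γ.Sp)) (θ : T)
    {ε : ℝ} (hε : 0 < ε) : ∀ᶠ θ' in 𝓝 θ, ∀ S, ‖Γ.Kmat S (F θ') - Γ.Kmat S (F θ)‖ ≤ ε := by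
  filter_upwards [eventually_forall_abs_sub_le_of_continuousOn Γ.isCompact_Sp hF θ hε]
    with θ' hθ' S
  exact Γ.norm_Kmat_sub_le S (hF.uncurry_left θ' (Set.mem_univ θ'))
    (hF.uncurry_left θ (Set.mem_univ θ)) hε.le hθ'

theorem exists_eventually_smul_one_le_Kmat (hF : ContinuousOn F.uncurry (Set.univ ×ˢ Γ.Sp)) (θ : T)
    (hpos : ∀ x ∈ Γ.Sp, 0 < F θ x) :
    ∃ c : ℝ, 0 < c ∧ ∀ᶠ θ' in 𝓝 θ, ∀ S, c • 1 ≤ Γ.Kmat S (F θ') := by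
  obtain ⟨c, hc, hcF⟩ := exists_eventually_forall_le_of_continuousOn Γ.isCompact_Sp hF θ hpos
  refine ⟨c, hc, hcF.mono fun θ' hθ' S => ?_⟩
  exact Γ.smul_one_le_Kmat S (hF.uncurry_left θ' (Set.mem_univ θ')) hθ'

theorem IsFolner.logTermConverges_log_det_Kmat (hV : Γ.IsFolner atTop V)
    (hμ : Tendsto (fun n => Γ.avgMeasure (V n)) atTop (𝓝 μ))
    (hF : ContinuousOn F.uncurry (Set.univ ×ˢ Γ.Sp)) (hpos : ∀ θ, ∀ x ∈ Γ.Sp, 0 < F θ x) :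
    LogTermConverges V (fun S θ => Real.log (Γ.Kmat S (F θ)).det)
      fun θ => ∫ x, Real.log (F θ x) ∂(μ : Measure ℝ) where
  equicontinuous θ ε hε := by
    obtain ⟨c, hc, hcK⟩ := exists_eventually_smul_one_le_Kmat hF θ (hpos θ)
    filter_upwards [hcK, eventually_forall_norm_Kmat_sub_le hF θ (mul_pos hc hε)]
      with θ' hθ' hnorm n
    calc |Real.log (Γ.Kmat (V n) (F θ')).det - Real.log (Γ.Kmat (V n) (F θ)).det|
        ≤ Fintype.card (V n) * (c⁻¹ * ‖Γ.Kmat (V n) (F θ') - Γ.Kmat (V n) (F θ)‖) :=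
          abs_log_det_sub_log_det_le hc (hθ' _) (hcK.self_of_nhds _)
      _ ≤ Fintype.card (V n) * (c⁻¹ * (c * ε)) := by
          gcongr
          exact hnorm _
      _ = ε * (V n).card := by
          rw [Fintype.card_coe, inv_mul_cancel_left₀ hc.ne', mul_comm]
  tendsto θ := hV.tendsto_log_det_Kmat hμ (hF.uncurry_left θ (Set.mem_univ θ)) (hpos θ)

theorem IsFolner.quadraticTermConverges_Kmat (hV : Γ.IsFolner atTop V)
    (hμ : Tendsto (fun n => Γ.avgMeasure (V n)) atTop (𝓝 μ))
    (hF : ContinuousOn F.uncurry (Set.univ ×ˢ Γ.Sp)) (hg : ContinuousOn g Γ.Sp) :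
    QuadraticTermConverges V (fun S => Γ.Kmat S g) (fun S θ => Γ.Kmat S (F θ))
      fun θ => ∫ x, F θ x * g x ∂(μ : Measure ℝ) where
  isHermitian n θ := Γ.isHermitian_Kmat (V n) (F θ)
  exists_norm_le θ := exists_norm_Kmat_le V (hF.uncurry_left θ (Set.mem_univ θ))
  equicontinuous θ _ hε :=
    (eventually_forall_norm_Kmat_sub_le hF θ hε).mono fun _ hθ' n => hθ' (V n)
  tendsto θ := hV.tendsto_trace_Kmat_mul hμ (hF.uncurry_left θ (Set.mem_univ θ)) hg

theorem IsFolner.quadraticTermConverges_Kmat_inv (hV : Γ.IsFolner atTop V)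
    (hμ : Tendsto (fun n => Γ.avgMeasure (V n)) atTop (𝓝 μ))
    (hF : ContinuousOn F.uncurry (Set.univ ×ˢ Γ.Sp)) (hpos : ∀ θ, ∀ x ∈ Γ.Sp, 0 < F θ x)
    (hg : ContinuousOn g Γ.Sp) :
    QuadraticTermConverges V (fun S => Γ.Kmat S g) (fun S θ => (Γ.Kmat S (F θ))⁻¹)
      fun θ => ∫ x, 1 / F θ x * g x ∂(μ : Measure ℝ) where
  isHermitian n θ := (Γ.isHermitian_Kmat (V n) (F θ)).inv
  exists_norm_le θ := by
    obtain ⟨c, hc, hcK⟩ := exists_eventually_smul_one_le_Kmat hF θ (hpos θ)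
    exact ⟨c⁻¹, fun n => norm_inv_le_of_smul_one_le hc (hcK.self_of_nhds (V n))⟩
  equicontinuous θ ε hε := by
    obtain ⟨c, hc, hcK⟩ := exists_eventually_smul_one_le_Kmat hF θ (hpos θ)
    filter_upwards [hcK, eventually_forall_norm_Kmat_sub_le hF θ (by positivity : 0 < c * ε * c)]
      with θ' hθ' hnorm n
    calc ‖(Γ.Kmat (V n) (F θ'))⁻¹ - (Γ.Kmat (V n) (F θ))⁻¹‖
        ≤ c⁻¹ * ‖Γ.Kmat (V n) (F θ') - Γ.Kmat (V n) (F θ)‖ * c⁻¹ :=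
          norm_inv_sub_inv_le hc (hθ' _) (hcK.self_of_nhds _)
      _ ≤ c⁻¹ * (c * ε * c) * c⁻¹ := by
          gcongr
          exact hnorm _
      _ = ε := by field_simp
  tendsto θ := hV.tendsto_trace_Kmat_inv_mul hμ (hF.uncurry_left θ (Set.mem_univ θ)) (hpos θ) hg

theorem IsFolner.quadraticTermConverges_Qmat (hV : Γ.IsFolner atTop V)
    (hμ : Tendsto (fun n => Γ.avgMeasure (V n)) atTop (𝓝 μ)) {P : ℕ} {u : ℕ → ℝ}
    (hu : Tendsto u atTop (𝓝 0)) (hB : ∀ n, ∀ i j : V n, |Γ.B P (V n) i j - 1| ≤ u n)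
    (hF : ContinuousOn F.uncurry (Set.univ ×ˢ Γ.Sp)) (hg : ContinuousOn g Γ.Sp) :
    QuadraticTermConverges V (fun S => Γ.Kmat S g) (fun S θ => Γ.Qmat P S (F θ))
      fun θ => ∫ x, F θ x * g x ∂(μ : Measure ℝ) := by
  obtain ⟨N, hN⟩ := Γ.exists_ncard_edist_le P
  obtain ⟨R, hR⟩ := hu.abs.bddAbove_range
  have hnorm {h : ℝ → ℝ} {C : ℝ} (hC : 0 ≤ C) (hhC : ∀ x ∈ Γ.Sp, |h x| ≤ C) (n : ℕ) :
      ‖Γ.Qmat P (V n) h‖ ≤ (N * |R| + 1) * C := by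
    refine Γ.norm_Qmat_le (hN _) (fun i j => (hB n i j).trans ?_) hC hhC
    exact (le_abs_self _).trans (hR ⟨n, rfl⟩)
  have hcont (θ : T) : ContinuousOn (F θ) Γ.Sp := hF.uncurry_left θ (Set.mem_univ θ)
  refine ⟨fun n θ => Γ.isHermitian_Qmat P (V n) (F θ), fun θ => ?_, fun θ ε hε => ?_, fun θ => ?_⟩
  · obtain ⟨C, hC, hFC⟩ := Γ.exists_abs_le (hcont θ)
    exact ⟨_, hnorm hC hFC⟩
  · filter_upwards [eventually_forall_abs_sub_le_of_continuousOn Γ.isCompact_Sp hF θ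
      (ε := ε / (N * |R| + 1)) (by positivity)] with θ' hθ' n
    rw [← Γ.Qmat_sub P (V n) (hcont θ') (hcont θ)]
    exact (hnorm (by positivity) hθ' n).trans_eq (by field_simp)
  · simpa [← add_div, ← Matrix.trace_add, ← add_mul] using
      (tendsto_trace_Qmat_sub_Kmat_mul hu hB (hcont θ) hg).add
        (hV.tendsto_trace_Kmat_mul hμ (hcont θ) hg)

end WeightedGraph

/-! ### The contrast between two spectral densities -/

theorem log_add_one_div_mul_self_lt {a b : ℝ} (ha : 0 < a) (hb : 0 < b) (hne : b ≠ a) :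
    Real.log a + 1 / a * a < Real.log b + 1 / b * a := by
  have hlog := Real.log_lt_sub_one_of_pos (div_pos ha hb) fun h =>
    hne ((div_eq_one_iff_eq hb.ne').1 h).symm
  rw [Real.log_div ha.ne' hb.ne'] at hlog
  rw [one_div_mul_cancel ha.ne', one_div_mul_eq_div]
  linarith

theorem integral_log_add_integral_one_div_mul_self_lt {α : Type*} [MeasurableSpace α]
    {ν : Measure α} {f g : α → ℝ} (hf : ∀ᵐ x ∂ν, 0 < f x) (hg : ∀ᵐ x ∂ν, 0 < g x)
    (hlogf : Integrable (fun x => Real.log (f x)) ν) (hff : Integrable (fun x => 1 / f x * f x) ν)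
    (hlogg : Integrable (fun x => Real.log (g x)) ν) (hgf : Integrable (fun x => 1 / g x * f x) ν)
    (hne : ¬ g =ᵐ[ν] f) :
    ∫ x, Real.log (f x) ∂ν + ∫ x, 1 / f x * f x ∂ν <
      ∫ x, Real.log (g x) ∂ν + ∫ x, 1 / g x * f x ∂ν := by
  have hle : (fun x => Real.log (f x) + 1 / f x * f x) ≤ᵐ[ν]
      fun x => Real.log (g x) + 1 / g x * f x := by
    filter_upwards [hf, hg] with x hfx hgx
    rcases eq_or_ne (g x) (f x) with h | h
    · rw [h]
    · exact (log_add_one_div_mul_self_lt hfx hgx h).le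
  rw [← integral_add hlogf hff, ← integral_add hlogg hgf]
  refine (integral_mono_ae (hlogf.add hff) (hlogg.add hgf) hle).lt_of_ne fun heq => hne ?_
  filter_upwards [hf, hg, (integral_eq_iff_of_ae_le (hlogf.add hff) (hlogg.add hgf) hle).1 heq]
    with x hfx hgx hx
  by_contra h
  exact (log_add_one_div_mul_self_lt hfx hgx h).ne hx

/-! ### Consistency of the estimators -/

open scoped Matrix.Norms.L2Operator in
theorem maximizersConverge_of_eq_neg_half_mul {G Ω : Type*} [DecidableEq G] [MeasurableSpace Ω]
    {Pr : Measure Ω} {V : ℕ → Finset G} {X : G → Ω → ℝ} {Cov : ∀ S : Finset G, Matrix S S ℝ} {C : ℝ}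
    {Θ : Set ℝ} {θ₀ : Θ} {D : Finset G → Θ → ℝ} {A : ∀ S : Finset G, Θ → Matrix S S ℝ} {d e : Θ → ℝ}
    {L : ℕ → ℝ → Ω → ℝ} {c : ℕ → ℝ} (hΘ : IsCompact Θ) (hV : Monotone V)
    (hcard : Tendsto (fun n => (V n).card) atTop atTop) (hX : IsGaussianProcess X Pr)
    (hX0 : ∀ i, ∫ ω, X i ω ∂Pr = 0) (hCov : ∀ n, (Cov (V n)).PosSemidef)
    (hXcov : ∀ n, ∀ i j : V n, cov[X i, X j; Pr] = Cov (V n) i j) (hC : ∀ n, ‖Cov (V n)‖ ≤ C)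
    (hD : LogTermConverges V D d) (hA : QuadraticTermConverges V Cov A e)
    (hmin : ∀ θ, θ ≠ θ₀ → d θ₀ + e θ₀ < d θ + e θ)
    (hL : ∀ n ω (θ : Θ), L n θ ω = -(1 / 2) * (c n + D (V n) θ +
      (fun i : V n => X i ω) ⬝ᵥ A (V n) θ *ᵥ (fun i : V n => X i ω))) :
    MaximizersConverge Pr Θ θ₀ L := by
  have := isCompact_iff_compactSpace.1 hΘ
  refine maximizersConverge_of_ae_tendsto_minimizers hΘ
    (F := fun n θ ω => empiricalContrast D A (V n) (fun i => X i ω) θ) (fun n ω θ θ' => ?_)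
    (fun n ω => continuous_empiricalContrast hD hA n _)
    (ae_tendsto_of_empiricalContrast_le hV hcard hX hX0 hCov hXcov hC hD hA hmin)
  rw [hL, hL, empiricalContrast, empiricalContrast]
  constructor <;> intro h <;> linarith

namespace WeightedGraph

variable {G : Type*} {Γ : WeightedGraph G}

theorem integral_log_add_integral_one_div_mul_lt {V : ℕ → Finset G} {μ : FiniteMeasure ℝ}
    (hμ : Tendsto (fun n => Γ.avgMeasure (V n)) atTop (𝓝 μ)) {f g : ℝ → ℝ}
    (hf : ContinuousOn f Γ.Sp) (hfpos : ∀ x ∈ Γ.Sp, 0 < f x) (hg : ContinuousOn g Γ.Sp)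
    (hgpos : ∀ x ∈ Γ.Sp, 0 < g x) (hne : ¬ g =ᵐ[(μ : Measure ℝ)] f) :
    ∫ x, Real.log (f x) ∂(μ : Measure ℝ) + ∫ x, 1 / f x * f x ∂(μ : Measure ℝ) <
      ∫ x, Real.log (g x) ∂(μ : Measure ℝ) + ∫ x, 1 / g x * f x ∂(μ : Measure ℝ) := by
  have hint {h : ℝ → ℝ} (hh : ContinuousOn h Γ.Sp) (hpos : ∀ x ∈ Γ.Sp, 0 < h x) :
      Integrable (fun x => Real.log (h x)) (μ : Measure ℝ) ∧
        Integrable (fun x => 1 / h x * f x) (μ : Measure ℝ) :=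
    ⟨integrable_of_continuousOn_Sp hμ (hh.log fun x hx => (hpos x hx).ne'),
      integrable_of_continuousOn_Sp hμ
        ((continuousOn_const.div hh fun x hx => (hpos x hx).ne').fun_mul hf)⟩
  exact integral_log_add_integral_one_div_mul_self_lt ((ae_mem_Sp hμ).mono hfpos)
    ((ae_mem_Sp hμ).mono hgpos) (hint hf hfpos).1 (hint hf hfpos).2 (hint hg hgpos).1
    (hint hg hgpos).2 hne

section MemFρ

variable {ρ : ℝ} {f : ℝ → ℝ}

theorem MemFρ.pos_of_mem_Sp (hf : Γ.MemFρ ρ f) {x : ℝ} (hx : x ∈ Γ.Sp) : 0 < f x :=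
  hf.pos x (subset_convexHull ℝ _ hx)

theorem MemFρ.lipschitzOnWith_log (hf : Γ.MemFρ ρ f) :
    LipschitzOnWith ρ.toNNReal (fun x => Real.log (f x)) Γ.Sp := by
  obtain ⟨c, hc, hsum, hle⟩ := hf.regular
  refine .of_dist_le' fun x hx y hy => ?_
  have habs {z : ℝ} (hz : z ∈ Γ.Sp) : |z| ≤ 1 := _root_.abs_le.2 (Γ.Sp_subset_Icc hz)
  have hpow (k : ℕ) : |x ^ k - y ^ k| ≤ (k + 1) * |x - y| := by
    calc |x ^ k - y ^ k| ≤ |x - y| * k * max |x| |y| ^ (k - 1) := abs_pow_sub_pow_le x y k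
      _ ≤ |x - y| * (k + 1) * 1 := by
          gcongr
          · exact (lt_add_one _).le
          · exact pow_le_one₀ (le_max_of_le_left (abs_nonneg x)) (max_le (habs hx) (habs hy))
      _ = (k + 1) * |x - y| := by ring
  have hterm (k : ℕ) : ‖c k * x ^ k - c k * y ^ k‖ ≤ |c k| * (k + 1) * |x - y| := by
    rw [Real.norm_eq_abs, ← mul_sub, abs_mul, mul_assoc]
    exact mul_le_mul_of_nonneg_left (hpow k) (abs_nonneg _)
  have hdiff := (hc x (subset_convexHull ℝ _ hx)).sub (hc y (subset_convexHull ℝ _ hy))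
  rw [Real.dist_eq, Real.dist_eq, ← hdiff.tsum_eq]
  exact (tsum_of_norm_bounded (hsum.hasSum.mul_right |x - y|) hterm).trans (by gcongr)

theorem continuousOn_uncurry_of_memFρ {T : Type*} [TopologicalSpace T] {Θ : Set T} {F : T → ℝ → ℝ}
    (hF : ∀ θ ∈ Θ, Γ.MemFρ ρ (F θ)) (hcont : ∀ x ∈ Γ.Sp, ContinuousOn (fun θ => F θ x) Θ) :
    ContinuousOn F.uncurry (Θ ×ˢ Γ.Sp) := by
  have hlog : ContinuousOn (fun p : T × ℝ => Real.log (F p.1 p.2)) (Θ ×ˢ Γ.Sp) :=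
    continuousOn_prod_of_continuousOn_lipschitzOnWith' _ ρ.toNNReal
      (fun θ hθ => (hF θ hθ).lipschitzOnWith_log)
      fun x hx => (hcont x hx).log fun θ hθ => ((hF θ hθ).pos_of_mem_Sp hx).ne'
  exact hlog.rexp.congr fun p hp => (Real.exp_log ((hF p.1 hp.1).pos_of_mem_Sp hp.2)).symm

end MemFρ

end WeightedGraph

section Estimators

variable {G Ω : Type*} {Γ : WeightedGraph G} {V : ℕ → Finset G} {μ : FiniteMeasure ℝ} {Θ : Set ℝ}
  {f : ℝ → ℝ → ℝ} {X : G → Ω → ℝ} [MeasurableSpace Ω] {Pr : Measure Ω}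

open WeightedGraph

open scoped Matrix.Norms.L2Operator in
theorem maximizersConverge_of_logTermConverges_of_quadraticTermConverges [DecidableEq G]
    (hV : Monotone V) (hcard : Tendsto (fun n => (V n).card) atTop atTop)
    (hμ : Tendsto (fun n => Γ.avgMeasure (V n)) atTop (𝓝 μ)) (hΘ : IsCompact Θ)
    (hf : ∀ θ : Θ, ContinuousOn (f θ) Γ.Sp) (hpos : ∀ θ : Θ, ∀ x ∈ Γ.Sp, 0 < f θ x) {θ₀ : Θ}
    (hident : ∀ θ : Θ, f θ =ᵐ[(μ : Measure ℝ)] f θ₀ → θ = θ₀) (hX : IsGaussianProcess X Pr)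
    (hX0 : ∀ i, ∫ ω, X i ω ∂Pr = 0) (hXcov : ∀ i j, cov[X i, X j; Pr] = Γ.K (f θ₀) i j)
    {D : Finset G → Θ → ℝ} {A : ∀ S : Finset G, Θ → Matrix S S ℝ} {L : ℕ → ℝ → Ω → ℝ} {c : ℕ → ℝ}
    (hD : LogTermConverges V D fun θ => ∫ x, Real.log (f θ x) ∂(μ : Measure ℝ))
    (hA : QuadraticTermConverges V (fun S => Γ.Kmat S (f θ₀)) A
      fun θ => ∫ x, 1 / f θ x * f θ₀ x ∂(μ : Measure ℝ))
    (hL : ∀ n ω (θ : Θ), L n θ ω = -(1 / 2) * (c n + D (V n) θ +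
      (fun i : V n => X i ω) ⬝ᵥ A (V n) θ *ᵥ (fun i : V n => X i ω))) :
    MaximizersConverge Pr Θ θ₀ L := by
  obtain ⟨C, hC⟩ := exists_norm_Kmat_le V (hf θ₀)
  exact maximizersConverge_of_eq_neg_half_mul (Cov := fun S => Γ.Kmat S (f θ₀)) hΘ hV hcard hX hX0
    (fun n => Γ.posSemidef_Kmat (V n) fun x hx => (hpos θ₀ x hx).le) (fun n i j => hXcov i j) hC
    hD hA (fun θ hθ => integral_log_add_integral_one_div_mul_lt hμ (hf θ₀) (hpos θ₀) (hf θ) (hpos θ)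
      fun h => hθ (hident θ h)) hL

theorem mainTheorem1_general (hV : Monotone V)
    (hcard : Tendsto (fun n => (V n).card) atTop atTop)
    (hboundary : (fun n => (Γ.boundaryCard (V n) : ℝ)) =o[atTop] fun n => ((V n).card : ℝ))
    (hμ : Tendsto (fun n => Γ.avgMeasure (V n)) atTop (𝓝 μ)) (hΘ : IsCompact Θ)
    (hf : ContinuousOn f.uncurry (Θ ×ˢ Γ.Sp)) (hpos : ∀ θ ∈ Θ, ∀ x ∈ Γ.Sp, 0 < f θ x)
    {θ₀ : ℝ} (hθ₀ : θ₀ ∈ Θ) (hident : ∀ θ ∈ Θ, f θ =ᵐ[(μ : Measure ℝ)] f θ₀ → θ = θ₀)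
    (hX : IsGaussianProcess X Pr) (hX0 : ∀ i, ∫ ω, X i ω ∂Pr = 0)
    (hXcov : ∀ i j, cov[X i, X j; Pr] = Γ.K (f θ₀) i j) :
    MaximizersConverge Pr Θ θ₀ (fun n θ ω => Γ.logLik (V n) (f θ) (fun i => X i ω)) ∧
      MaximizersConverge Pr Θ θ₀ (fun n θ ω => Γ.logLikBar μ (V n) (f θ) (fun i => X i ω)) ∧
      MaximizersConverge Pr Θ θ₀ (fun n θ ω => Γ.logLikTilde μ (V n) (f θ) (fun i => X i ω)) ∧
      ∀ (P : ℕ) (u : ℕ → ℝ), Tendsto u atTop (𝓝 0) →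
        (∀ n, ∀ i j : V n, |Γ.B P (V n) i j - 1| ≤ u n) →
        MaximizersConverge Pr Θ θ₀
          (fun n θ ω => Γ.logLikUnb μ P (V n) (f θ) (fun i => X i ω)) := by
  classical
  lift θ₀ to Θ using hθ₀
  have hFolner : Γ.IsFolner atTop V := hboundary
  have hpos' (θ : Θ) : ∀ x ∈ Γ.Sp, 0 < f θ x := hpos θ θ.2
  have hF : ContinuousOn (Function.uncurry fun θ : Θ => f θ) (Set.univ ×ˢ Γ.Sp) :=
    hf.comp (f := Prod.map Subtype.val id) (by fun_prop) fun p hp => ⟨p.1.2, hp.2⟩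
  have hlogF : ContinuousOn (Function.uncurry fun (θ : Θ) x => Real.log (f θ x))
      (Set.univ ×ˢ Γ.Sp) := hF.log fun p hp => (hpos' p.1 p.2 hp.2).ne'
  have hinvF : ContinuousOn (Function.uncurry fun (θ : Θ) x => 1 / f θ x) (Set.univ ×ˢ Γ.Sp) :=
    continuousOn_const.div hF fun p hp => (hpos' p.1 p.2 hp.2).ne'
  have hf' (θ : Θ) : ContinuousOn (f θ) Γ.Sp := hF.uncurry_left θ (Set.mem_univ θ)
  have hlogDet := hFolner.logTermConverges_log_det_Kmat hμ hF hpos'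
  have hlogInt := logTermConverges_card_mul_integral hcard hμ hlogF
  have hinv := hFolner.quadraticTermConverges_Kmat_inv hμ hF hpos' (hf' θ₀)
  have hconv {D A L c} := maximizersConverge_of_logTermConverges_of_quadraticTermConverges
    (D := D) (A := A) (L := L) (c := c) hV hcard hμ hΘ hf' hpos'
    (fun θ h => Subtype.ext (hident θ θ.2 h)) hX hX0 hXcov
  exact ⟨hconv hlogDet hinv fun _ _ _ => rfl, hconv hlogInt hinv fun _ _ _ => rfl,
    hconv hlogInt (hFolner.quadraticTermConverges_Kmat hμ hinvF (hf' θ₀)) fun _ _ _ => rfl,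
    fun P u hu hB => hconv hlogInt
      (hFolner.quadraticTermConverges_Qmat hμ hu hB hinvF (hf' θ₀)) fun _ _ _ => rfl⟩

end Estimators

theorem mainTheorem1 {G : Type*} [Countable G] (Γ : WeightedGraph G)
    -- growing nested finite sets of vertices with small boundary
    (V : ℕ → Finset G) (hV : Monotone V)
    (hcard : Tendsto (fun n => (V n).card) atTop atTop)
    (hboundary : (fun n => (Γ.boundaryCard (V n) : ℝ)) =o[atTop] fun n => ((V n).card : ℝ))
    -- the spectral measure
    (μ : FiniteMeasure ℝ) (hμ : Tendsto (fun n => Γ.avgMeasure (V n)) atTop (𝓝 μ))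
    -- the parametric family of spectral densities
    (a b : ℝ) (ρ : ℝ) (hρ : 0 < ρ) (f : ℝ → ℝ → ℝ)
    (hinj : ∀ θ ∈ Set.Icc a b, ∀ θ' ∈ Set.Icc a b, f θ =ᵐ[(μ : Measure ℝ)] f θ' → θ = θ')
    (hcont : ∀ x ∈ Γ.Sp, ContinuousOn (fun θ => f θ x) (Set.Icc a b))
    (hreg : ∀ θ ∈ Set.Icc a b, Γ.MemFρ ρ (f θ))
    (θ₀ : ℝ) (hθ₀ : θ₀ ∈ interior (Set.Icc a b))
    -- the centered Gaussian process with spectral density `f θ₀`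
    {Ω : Type*} [MeasurableSpace Ω] (Pr : Measure Ω) [IsProbabilityMeasure Pr]
    (X : G → Ω → ℝ) (hX : IsGaussianProcess X Pr) (hX0 : ∀ i, ∫ ω, X i ω ∂Pr = 0)
    (hXcov : ∀ i j, cov[X i, X j; Pr] = Γ.K (f θ₀) i j) :
    MaximizersConverge Pr (Set.Icc a b) θ₀
        (fun n θ ω => Γ.logLik (V n) (f θ) (fun i => X i ω)) ∧
      MaximizersConverge Pr (Set.Icc a b) θ₀
        (fun n θ ω => Γ.logLikBar μ (V n) (f θ) (fun i => X i ω)) ∧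
      MaximizersConverge Pr (Set.Icc a b) θ₀
        (fun n θ ω => Γ.logLikTilde μ (V n) (f θ) (fun i => X i ω)) ∧
      ∀ P : ℕ, 0 < P →
        (∃ u : ℕ → ℝ, (∀ n, 0 < u n) ∧ Tendsto u atTop (𝓝 0) ∧
          ∀ n, ∀ i j : V n, |Γ.B P (V n) i j - 1| ≤ u n) →
        MaximizersConverge Pr (Set.Icc a b) θ₀
          (fun n θ ω => Γ.logLikUnb μ P (V n) (f θ) (fun i => X i ω)) := by
  have hmem := interior_subset hθ₀
  obtain ⟨hL, hLbar, hLtilde, hLunb⟩ := mainTheorem1_general hV hcard hboundary hμ isCompact_Icc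
    (WeightedGraph.continuousOn_uncurry_of_memFρ hreg hcont)
    (fun θ hθ _ hx => (hreg θ hθ).pos_of_mem_Sp hx) hmem
    (fun θ hθ => hinj θ hθ θ₀ hmem) hX hX0 hXcov
  exact ⟨hL, hLbar, hLtilde, fun P _ ⟨u, _, hu, hB⟩ => hLunb P u hu hB⟩
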